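/- Let $\mathbb S^2\subset\mathbb R^3$ be the round unit sphere with its surface measure $\sigma$ normalized to $\sigma(\mathbb S^2)=1$, and let $\Delta_g$ be its Laplace--Beltrami operator. For $n=0,1,2,\dots$ let $E_n\subset L^2(\mathbb S^2;\mathbb C)$ be the space of spherical harmonics of degree $n$, i.e. the eigenspace of $-\Delta_g$ for the eigenvalue $n(n+1)$, which has dimension $2n+1$; let $\pi_n$ be the orthogonal projection onto $E_n$, let $\lambda_n=\sqrt{n^2+n+1}$, and let $(\mathbf b_{n,k})_{|k|\le n}$ be an orthonormal basis of $E_n$. For $\phi\in L^2(\mathbb S^2)$ put $e^{it\Delta_g}\phi=\sum_{n\ge 0}e^{-itn(n+1)}\pi_n\phi$ (convergence in $L^2$). Let $(g_{n,k})_{n\ge 0,\,|k|\le n}$ be independent standard complex Gaussian random variables (so $\mathbb E|g_{n,k}|^2=1$) on a probability space $(\Omega,\mathcal F,\mathbb P)$. **Theorem.** Let $\alpha>1$. Almost surely the series $$\phi_\alpha^\omega=\sum_{n=0}^\infty \lambda_n^{-\alpha}\sum_{|k|\le n} g_{n,k}(\omega)\,\mathbf b_{n,k}$$ converges in $L^2(\mathbb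 S^2)$, and it defines a random element of $L^2(\mathbb S^2)$. Let $\mu_\alpha$ be its law on $L^2(\mathbb S^2)$ (the Gaussian measure with covariance operator $(-\Delta_g+1)^{-\alpha}$). Then for $\mu_\alpha$-almost every $\phi$ the function $(t,x)\mapsto e^{it\Delta_g}\phi(x)$ has a (necessarily unique) continuous version $u$ on $\mathbb R\times\mathbb S^2$, that is, $u$ is continuous and $u(t,\cdot)=e^{it\Delta_g}\phi$ $\sigma$-almost everywhere for every $t\in\mathbb R$; and, with $e^{it\Delta_g}\phi(x)=u(t,x)$, $$\lim_{t\to 0}e^{it\Delta_g}\phi(x)=\phi(x)\quad\text{for almost every }x\in\mathbb S^2 .$$ Moreover the convergence is uniform in $x$: $u(t,\cdot)\to u(0,\cdot)$ uniformly on $\mathbb S^2$, and $\lim_{t\to0}\|e^{it\Delta_g}\phi-\phi\|_{L^\infty(\mathbb S^2)}=0$. -/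

import Mathlib

open MeasureTheory ProbabilityTheory Filter Topology
open scoped ENNReal

namespace SphereSchrodinger

noncomputable section

/-- Three-dimensional Euclidean space. -/
abbrev E3 : Type := EuclideanSpace ℝ (Fin 3)

/-- The round unit sphere in three-dimensional Euclidean space. -/
abbrev S2 : Type := Metric.sphere (0 : E3) 1

/-- The surface measure of the unit sphere, normalized to have total mass `1`. -/
def sphereMeasure : Measure S2 :=
  ((volume : Measure E3).toSphere Set.univ)⁻¹ • (volume : Measure E3).toSphere

/-- The complex Hilbert space of square integrable functions on the sphere. -/
abbrev L2S2 : Type := Lp ℂ 2 sphereMeasure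

/-- The Hilbert space of square integrable functions carries its Borel σ-algebra. -/
instance : MeasurableSpace L2S2 := borel L2S2

instance : BorelSpace L2S2 := ⟨rfl⟩

/-- The extension of a function on the sphere to a function on Euclidean space that is constant
along the open rays from the origin (with value `0` at the origin). -/
def radialExtension (f : S2 → ℂ) (y : E3) : ℂ :=
  if h : y = 0 then 0
  else f ⟨‖y‖⁻¹ • y, by simp [norm_smul, h]⟩

/-- A function on the sphere is smooth if its radially constant extension is smooth away from the
origin. -/
def IsSmooth (f : S2 → ℂ) : Prop :=
  ContDiffOn ℝ ((⊤ : ℕ∞) : WithTop ℕ∞) (radialExtension f) {0}ᶜ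

/-- The Laplace–Beltrami operator of the round sphere: the Euclidean Laplacian of the radially
constant extension, restricted to the sphere. -/
def laplaceBeltrami (f : S2 → ℂ) (x : S2) : ℂ :=
  Laplacian.laplacian (radialExtension f) (x : E3)

lemma radialExtension_add (f g : S2 → ℂ) :
    radialExtension (f + g) = radialExtension f + radialExtension g := by
  funext y
  by_cases h : y = 0 <;> simp [radialExtension, h]

lemma radialExtension_smul (c : ℂ) (f : S2 → ℂ) :
    radialExtension (c • f) = c • radialExtension f := by
  funext y
  by_cases h : y = 0 <;> simp [radialExtension, h]

lemma radialExtension_zero : radialExtension 0 = 0 := by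
  funext y
  by_cases h : y = 0 <;> simp [radialExtension, h]

lemma IsSmooth.contDiffAt {f : S2 → ℂ} (hf : IsSmooth f) (x : S2) :
    ContDiffAt ℝ 2 (radialExtension f) (x : E3) := by
  have hx : (x : E3) ≠ 0 := ne_zero_of_mem_unit_sphere x
  have h : ContDiffAt ℝ ((⊤ : ℕ∞) : WithTop ℕ∞) (radialExtension f) (x : E3) :=
    ContDiffOn.contDiffAt hf (isOpen_compl_singleton.mem_nhds hx)
  exact h.of_le (WithTop.coe_le_coe.2 le_top)

/-- The space of spherical harmonics of degree `n`, i.e. the eigenspace of minus the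
Laplace–Beltrami operator for the eigenvalue `n (n + 1)`, as a subspace of the Hilbert space. -/
def harmonicSpace (n : ℕ) : Submodule ℂ L2S2 where
  carrier := {φ | ∃ f : S2 → ℂ, IsSmooth f ∧
    (∀ x, -laplaceBeltrami f x = ((n : ℂ) * ((n : ℂ) + 1)) * f x) ∧ φ =ᵐ[sphereMeasure] f}
  add_mem' := by
    rintro φ ψ ⟨f, hf, hfe, hφ⟩ ⟨g, hg, hge, hψ⟩
    refine ⟨f + g, ?_, fun x => ?_, ?_⟩
    · unfold IsSmooth
      rw [radialExtension_add]
      exact ContDiffOn.add hf hg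
    · have h := (hf.contDiffAt x).laplacian_add (hg.contDiffAt x)
      have h1 := hfe x
      have h2 := hge x
      unfold laplaceBeltrami at h1 h2 ⊢
      rw [radialExtension_add, h, neg_add, h1, h2, Pi.add_apply]
      ring
    · exact (Lp.coeFn_add φ ψ).trans (hφ.add hψ)
  zero_mem' := by
    refine ⟨0, ?_, fun x => ?_, Lp.coeFn_zero ℂ 2 sphereMeasure⟩
    · unfold IsSmooth
      rw [radialExtension_zero]
      exact contDiffOn_const (c := (0 : ℂ))
    · have h : Laplacian.laplacian (0 : E3 → ℂ) = 0 :=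
        InnerProductSpace.laplacian_const (c := (0 : ℂ))
      unfold laplaceBeltrami
      rw [radialExtension_zero, h]
      simp
  smul_mem' := by
    rintro c φ ⟨f, hf, hfe, hφ⟩
    refine ⟨c • f, ?_, fun x => ?_, ?_⟩
    · unfold IsSmooth
      rw [radialExtension_smul]
      exact ContDiffOn.const_smul c hf
    · have h := InnerProductSpace.laplacian_smul c (hf.contDiffAt x)
      have h1 := hfe x
      unfold laplaceBeltrami at h1 ⊢
      rw [radialExtension_smul, h, ← smul_neg, h1, Pi.smul_apply, smul_eq_mul, smul_eq_mul]
      ring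
    · exact (Lp.coeFn_smul c φ).trans (hφ.const_smul c)

/-- The spectral projection onto the spherical harmonics of degree `n`: the orthogonal projection
onto the (closure of the) eigenspace. The eigenspace is finite-dimensional, hence closed; the
closure is only written so that the projection is defined without proving this first. -/
def spectralProjection (n : ℕ) : L2S2 →L[ℂ] L2S2 :=
  (harmonicSpace n).topologicalClosure.starProjection

/-- The linear Schrödinger flow `e^{itΔ}`, where `Δ` is the Laplace–Beltrami operator: it
multiplies the spherical harmonics of degree `n` by `e^{-itn(n+1)}`. The series converges in the
Hilbert space, its terms being orthogonal with square summable norms. -/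
def schrodingerFlow (t : ℝ) (φ : L2S2) : L2S2 :=
  ∑' n : ℕ, Complex.exp (-(Complex.I * (t : ℂ) * ((n : ℂ) * ((n : ℂ) + 1)))) •
    spectralProjection n φ

/-- The eigenvalues of the square root of `1 - Δ` on the sphere. -/
def eigenfrequency (n : ℕ) : ℝ := √((n : ℝ) ^ 2 + n + 1)

/-- The orders `k` with `|k| ≤ n`. -/
abbrev Order (n : ℕ) : Type := ↥(Finset.Icc (-(n : ℤ)) (n : ℤ))

/-- The standard complex Gaussian law: independent centred real and imaginary parts of
variance `1/2`. -/
def stdComplexGaussian : Measure ℂ :=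
  ((gaussianReal 0 (1 / 2)).prod (gaussianReal 0 (1 / 2))).map
    (fun p : ℝ × ℝ => (p.1 : ℂ) + (p.2 : ℂ) * Complex.I)

/-- The degree-`n` part of the randomized data, for coefficients `g` and orthonormal bases `b`. -/
def randomPart (α : ℝ) (b : ∀ n : ℕ, OrthonormalBasis (Order n) ℂ (harmonicSpace n))
    (g : ∀ n : ℕ, Order n → ℂ) (n : ℕ) : L2S2 :=
  ((eigenfrequency n ^ (-α) : ℝ) : ℂ) • ∑ k : Order n, g n k • (b n k : L2S2)

/-- The randomized data: the sum in the Hilbert space of its degree-`n` parts. -/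
def randomData (α : ℝ) (b : ∀ n : ℕ, OrthonormalBasis (Order n) ℂ (harmonicSpace n))
    (g : ∀ n : ℕ, Order n → ℂ) : L2S2 :=
  ∑' n : ℕ, randomPart α b g n

/-- The law of the randomized data on the Hilbert space. -/
def dataLaw {Ω : Type*} [MeasurableSpace Ω] (P : Measure Ω) (α : ℝ)
    (b : ∀ n : ℕ, OrthonormalBasis (Order n) ℂ (harmonicSpace n))
    (g : ∀ n : ℕ, Order n → Ω → ℂ) : Measure L2S2 :=
  P.map (fun ω => randomData α b (fun n k => g n k ω))

/-- `u` is the jointly continuous version of `(t, x) ↦ (e^{itΔ} φ)(x)`: it is continuous on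
`ℝ × S²` and for every time `t` it represents the class `e^{itΔ} φ`. There is at most one such
`u`, since nonempty open subsets of the sphere have positive measure. -/
def IsContinuousVersion (φ : L2S2) (u : ℝ → S2 → ℂ) : Prop :=
  Continuous (fun p : ℝ × S2 => u p.1 p.2) ∧
    ∀ t : ℝ, schrodingerFlow t φ =ᵐ[sphereMeasure] u t

end

end SphereSchrodinger

/-!
The flow multiplies the component of degree `n` by a factor of modulus one, and in the Hilbert
space everything follows from the orthogonality of the spaces of spherical harmonics. The point is
to show that almost surely the series for the flow converges uniformly in time and space when it is
summed in dyadic blocks of degrees (`dyadicBlock`); the sum is then the continuous version, and the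
uniform convergence as `t → 0` is the uniform continuity of a continuous function on a compact set.

* At a fixed point of space-time the block of degrees `n ≈ 2 ^ j` is a complex Gaussian variable,
  whose variance is `∑ λₙ ^ (-2 α) (2 n + 1) ≲ 4 ^ ((1 - α) j)` because the sum of the squares of an
  orthonormal basis of spherical harmonics is the constant `2 n + 1` (`sum_norm_sq_rep`). It is
  therefore sub-Gaussian, and its tail (`measureReal_norm_sum_ge_le`) is small enough to beat any
  number of points that is exponential in `j`; by Borel–Cantelli the block is almost surely at most
  `2 * 2 ^ ((1 - α) j / 2)` at all points of such a grid, for all large `j`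
  (`ae_eventually_norm_block_lt`). Here `α > 1` is used.
* Between the points of the grid a block varies by at most a power of `2 ^ j`, times the mesh, times
  the `L²` norm of the data (`norm_blockFlow_sub_le`). Using spherical coordinates, this reduces to
  the bound `norm_rotate_sub_le` for the action of rotations on spherical harmonics.

Both the orthogonality and this bound come from one fact, `tendsto_casimirDiff`: the symmetric
second differences of a spherical harmonic along the rotations about the three axes sum up to
minus `n (n + 1)` times the function in the limit. It holds pointwise by the chain rule, hence in
`L²` since the space is finite-dimensional. The second differences are symmetric because rotations
preserve the measure.

To pass from almost every `ω` to almost every `φ` for the law of the data, the good event is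
written as a Borel set `goodSet` of the Hilbert space. Its elements are required to be the sum of
their components, so the completeness of the spherical harmonics is not used.
-/

namespace SphereSchrodinger

noncomputable section

/-! ### Rotations of the sphere -/

instance : IsProbabilityMeasure sphereMeasure := by
  refine ⟨?_⟩
  have h0 : (volume : Measure E3).toSphere Set.univ ≠ 0 :=
    (Measure.measure_univ_ne_zero).2 (Measure.toSphere_ne_zero _)
  simp only [sphereMeasure, Measure.smul_apply, smul_eq_mul]
  exact ENNReal.inv_mul_cancel h0 (measure_ne_top _ _)

instance : Measure.IsOpenPosMeasure sphereMeasure := by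
  unfold sphereMeasure
  exact Measure.isOpenPosMeasure_smul _ (ENNReal.inv_ne_zero.2 (measure_ne_top _ _))

/-- The action of a linear isometry of Euclidean space on the sphere. -/
def sphereMap (R : E3 ≃ₗᵢ[ℝ] E3) (x : S2) : S2 :=
  ⟨R x, by simp⟩

@[simp] lemma coe_sphereMap (R : E3 ≃ₗᵢ[ℝ] E3) (x : S2) : (sphereMap R x : E3) = R x := rfl

lemma continuous_sphereMap (R : E3 ≃ₗᵢ[ℝ] E3) : Continuous (sphereMap R) :=
  (R.continuous.comp continuous_subtype_val).subtype_mk _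

lemma measurePreserving_sphereMap (R : E3 ≃ₗᵢ[ℝ] E3) :
    MeasurePreserving (sphereMap R) sphereMeasure sphereMeasure := by
  have hm : Measurable (sphereMap R) := (continuous_sphereMap R).measurable
  have key : MeasurePreserving (sphereMap R) (volume : Measure E3).toSphere
      (volume : Measure E3).toSphere := by
    refine ⟨hm, ?_⟩
    ext s hs
    rw [Measure.map_apply hm hs, Measure.toSphere_apply' _ hs, Measure.toSphere_apply' _ (hm hs)]
    congr 1
    conv_rhs =>
      rw [← R.measurePreserving.measure_preimage_equiv (f := R.toHomeomorph.toMeasurableEquiv)]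
    congr 1
    ext y
    simp only [Set.mem_smul, Set.mem_image, Set.mem_preimage]
    constructor
    · rintro ⟨r, hr, _, ⟨x, hx, rfl⟩, rfl⟩
      refine ⟨r, hr, _, ⟨_, hx, rfl⟩, ?_⟩
      exact (map_smul R r (x : E3)).symm
    · rintro ⟨r, hr, _, ⟨x, hx, rfl⟩, hy⟩
      refine ⟨r, hr, _, ⟨sphereMap R.symm x, ?_, rfl⟩, ?_⟩
      · have : sphereMap R (sphereMap R.symm x) = x := by ext1; simp
        rwa [this]
      · have hy' : r • (x : E3) = R y := hy
        rw [coe_sphereMap, ← map_smul, hy', R.symm_apply_apply]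
  exact key.smul_measure _

lemma radialExtension_comp (f : S2 → ℂ) (R : E3 ≃ₗᵢ[ℝ] E3) :
    radialExtension (f ∘ sphereMap R) = radialExtension f ∘ R := by
  funext y
  by_cases h : y = 0
  · simp [radialExtension, h]
  · have h' : R y ≠ 0 := by simpa using h
    simp only [radialExtension, h, h', dite_false, Function.comp_apply]
    congr 1
    ext1
    simp

lemma IsSmooth.comp_sphereMap {f : S2 → ℂ} (hf : IsSmooth f) (R : E3 ≃ₗᵢ[ℝ] E3) :
    IsSmooth (f ∘ sphereMap R) := by
  unfold IsSmooth
  rw [radialExtension_comp]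
  refine ContDiffOn.comp hf R.contDiff.contDiffOn ?_
  intro y hy
  simpa using hy

lemma laplacian_comp_isometry (F : E3 → ℂ) (R : E3 ≃ₗᵢ[ℝ] E3) (y : E3) :
    Laplacian.laplacian (F ∘ R) y = Laplacian.laplacian F (R y) := by
  let e := EuclideanSpace.basisFun (Fin 3) ℝ
  rw [congrFun (InnerProductSpace.laplacian_eq_iteratedFDeriv_orthonormalBasis (F ∘ R) e) y,
    congrFun (InnerProductSpace.laplacian_eq_iteratedFDeriv_orthonormalBasis F (e.map R)) (R y)]
  refine Finset.sum_congr rfl fun i _ => ?_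
  have h := R.toContinuousLinearEquiv.iteratedFDerivWithin_comp_right F uniqueDiffOn_univ
    (Set.mem_univ (R y)) 2
  simp only [Set.preimage_univ, iteratedFDerivWithin_univ] at h
  have h2 : F ∘ R = F ∘ R.toContinuousLinearEquiv := rfl
  rw [h2, show iteratedFDeriv ℝ 2 (F ∘ R.toContinuousLinearEquiv) y = _ from h]
  simp only [ContinuousMultilinearMap.compContinuousLinearMap_apply]
  congr 1
  funext j
  fin_cases j <;> simp

lemma laplaceBeltrami_comp (f : S2 → ℂ) (R : E3 ≃ₗᵢ[ℝ] E3) (x : S2) :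
    laplaceBeltrami (f ∘ sphereMap R) x = laplaceBeltrami f (sphereMap R x) := by
  unfold laplaceBeltrami
  rw [radialExtension_comp, laplacian_comp_isometry]
  rfl

lemma radialExtension_coe (f : S2 → ℂ) (x : S2) : radialExtension f x = f x := by
  have hx : (x : E3) ≠ 0 := ne_zero_of_mem_unit_sphere x
  simp only [radialExtension, hx, dite_false]
  congr 1
  ext1
  simp

lemma radialExtension_pos_smul (f : S2 → ℂ) {r : ℝ} (hr : 0 < r) (y : E3) :
    radialExtension f (r • y) = radialExtension f y := by
  by_cases h : y = 0
  · simp [h]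
  · have h' : r • y ≠ 0 := by simp [h, hr.ne']
    simp only [radialExtension, h, h', dite_false]
    congr 1
    ext1
    simp only [norm_smul, smul_smul, Real.norm_of_nonneg hr.le]
    congr 1
    have : ‖y‖ ≠ 0 := norm_ne_zero_iff.2 h
    field_simp

lemma IsSmooth.continuous {f : S2 → ℂ} (hf : IsSmooth f) : Continuous f := by
  have h : Continuous fun x : S2 => radialExtension f x :=
    continuous_iff_continuousAt.2 fun x =>
      (hf.contDiffAt x).continuousAt.comp continuous_subtype_val.continuousAt
  simpa only [radialExtension_coe] using h

lemma exists_sphereMap_eq (x y : S2) : ∃ R : E3 ≃ₗᵢ[ℝ] E3, sphereMap R x = y := by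
  refine ⟨((ℝ ∙ ((x : E3) - y))ᗮ).reflection, ?_⟩
  ext1
  exact Submodule.reflection_sub (by simp)

/-! ### Continuous representatives of spherical harmonics -/

lemma exists_rep {n : ℕ} (φ : harmonicSpace n) :
    ∃ f : C(S2, ℂ), IsSmooth f ∧
      (∀ x, -laplaceBeltrami f x = ((n : ℂ) * ((n : ℂ) + 1)) * f x) ∧
      (φ : L2S2) =ᵐ[sphereMeasure] f := by
  obtain ⟨f, hf, hfe, hφ⟩ := φ.2
  exact ⟨⟨f, hf.continuous⟩, hf, hfe, hφ⟩

lemma continuousMap_eq_of_ae_eq {f g : C(S2, ℂ)} (h : f =ᵐ[sphereMeasure] g) : f = g :=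
  DFunLike.coe_injective ((Continuous.ae_eq_iff_eq sphereMeasure f.continuous g.continuous).1 h)

/-- The smooth representative of a spherical harmonic. -/
def rep (n : ℕ) : harmonicSpace n →ₗ[ℂ] C(S2, ℂ) where
  toFun φ := (exists_rep φ).choose
  map_add' φ ψ := by
    refine continuousMap_eq_of_ae_eq ?_
    refine (exists_rep (φ + ψ)).choose_spec.2.2.symm.trans ?_
    refine (Lp.coeFn_add (φ : L2S2) ψ).trans ?_
    exact (exists_rep φ).choose_spec.2.2.add (exists_rep ψ).choose_spec.2.2
  map_smul' c φ := by
    refine continuousMap_eq_of_ae_eq ?_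
    refine (exists_rep (c • φ)).choose_spec.2.2.symm.trans ?_
    refine (Lp.coeFn_smul c (φ : L2S2)).trans ?_
    exact (exists_rep φ).choose_spec.2.2.const_smul c

lemma isSmooth_rep {n : ℕ} (φ : harmonicSpace n) : IsSmooth (rep n φ) :=
  (exists_rep φ).choose_spec.1

lemma laplaceBeltrami_rep {n : ℕ} (φ : harmonicSpace n) (x : S2) :
    -laplaceBeltrami (rep n φ) x = ((n : ℂ) * ((n : ℂ) + 1)) * rep n φ x :=
  (exists_rep φ).choose_spec.2.1 x

lemma coeFn_ae_eq_rep {n : ℕ} (φ : harmonicSpace n) :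
    (φ : L2S2) =ᵐ[sphereMeasure] rep n φ :=
  (exists_rep φ).choose_spec.2.2

lemma rep_eq_of_ae_eq {n : ℕ} {φ : harmonicSpace n} {f : C(S2, ℂ)}
    (h : (φ : L2S2) =ᵐ[sphereMeasure] f) : rep n φ = f :=
  continuousMap_eq_of_ae_eq ((coeFn_ae_eq_rep φ).symm.trans h)

lemma norm_sq_eq_integral_rep {n : ℕ} (φ : harmonicSpace n) :
    ‖φ‖ ^ 2 = ∫ x, ‖rep n φ x‖ ^ 2 ∂sphereMeasure := by
  have h : ‖(φ : L2S2)‖ ^ 2 = RCLike.re (inner ℂ (φ : L2S2) (φ : L2S2)) :=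
    (inner_self_eq_norm_sq (𝕜 := ℂ) _).symm
  rw [Submodule.coe_norm, h, L2.inner_def]
  have h2 : ∀ᵐ x ∂sphereMeasure, inner ℂ ((φ : L2S2) x) ((φ : L2S2) x) =
      ((‖rep n φ x‖ ^ 2 : ℝ) : ℂ) := by
    filter_upwards [coeFn_ae_eq_rep φ] with x hx
    rw [hx, inner_self_eq_norm_sq_to_K]
    norm_cast
  rw [integral_congr_ae h2]
  exact (congrArg Complex.re integral_complex_ofReal).trans (Complex.ofReal_re _)

/-- The action of a linear isometry of Euclidean space on functions on the sphere. -/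
def rotateL2 (R : E3 ≃ₗᵢ[ℝ] E3) : L2S2 →ₗᵢ[ℂ] L2S2 :=
  Lp.compMeasurePreservingₗᵢ ℂ (sphereMap R) (measurePreserving_sphereMap R)

lemma coeFn_rotateL2 (R : E3 ≃ₗᵢ[ℝ] E3) (φ : L2S2) :
    rotateL2 R φ =ᵐ[sphereMeasure] φ ∘ sphereMap R :=
  Lp.coeFn_compMeasurePreserving φ (measurePreserving_sphereMap R)

lemma rotateL2_ae_eq_rep (R : E3 ≃ₗᵢ[ℝ] E3) {n : ℕ} (φ : harmonicSpace n) :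
    rotateL2 R φ =ᵐ[sphereMeasure] rep n φ ∘ sphereMap R :=
  (coeFn_rotateL2 R φ).trans
    ((measurePreserving_sphereMap R).quasiMeasurePreserving.ae_eq_comp (coeFn_ae_eq_rep φ))

lemma rotateL2_mem (R : E3 ≃ₗᵢ[ℝ] E3) {n : ℕ} (φ : harmonicSpace n) :
    rotateL2 R φ ∈ harmonicSpace n := by
  refine ⟨rep n φ ∘ sphereMap R, (isSmooth_rep φ).comp_sphereMap R, fun x => ?_,
    rotateL2_ae_eq_rep R φ⟩
  rw [laplaceBeltrami_comp, laplaceBeltrami_rep, Function.comp_apply]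

/-- The action of a linear isometry of Euclidean space on the spherical harmonics of degree `n`. -/
def rotate (n : ℕ) (R : E3 ≃ₗᵢ[ℝ] E3) : harmonicSpace n →ₗᵢ[ℂ] harmonicSpace n where
  toLinearMap := (rotateL2 R).toLinearMap.restrict fun φ hφ => rotateL2_mem R ⟨φ, hφ⟩
  norm_map' φ := (rotateL2 R).norm_map φ

@[simp] lemma rep_rotate (n : ℕ) (R : E3 ≃ₗᵢ[ℝ] E3) (φ : harmonicSpace n) (x : S2) :
    rep n (rotate n R φ) x = rep n φ (sphereMap R x) := by
  have h : rep n (rotate n R φ) = (rep n φ).comp ⟨sphereMap R, continuous_sphereMap R⟩ :=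
    rep_eq_of_ae_eq (rotateL2_ae_eq_rep R φ)
  rw [h]
  rfl

lemma rep_injective (n : ℕ) : Function.Injective (rep n) := by
  intro φ ψ h
  apply Subtype.ext
  apply Lp.ext
  exact (coeFn_ae_eq_rep φ).trans (by rw [h]; exact (coeFn_ae_eq_rep ψ).symm)

lemma harmonic_ext {n : ℕ} {φ ψ : harmonicSpace n} (h : ∀ x, rep n φ x = rep n ψ x) : φ = ψ :=
  rep_injective n (ContinuousMap.ext h)

/-! ### Second differences along rotations -/

/-- The infinitesimal rotation about the `i`-th coordinate axis, `x ↦ eᵢ × x`. -/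
def crossAxis (i : Fin 3) : E3 →ₗ[ℝ] E3 where
  toFun x := x (i + 1) • EuclideanSpace.single (i + 2) (1 : ℝ) -
    x (i + 2) • EuclideanSpace.single (i + 1) (1 : ℝ)
  map_add' x y := by simp only [PiLp.add_apply]; module
  map_smul' c x := by simp only [PiLp.smul_apply, RingHom.id_apply, smul_eq_mul]; module

lemma crossAxis_apply (i : Fin 3) (x : E3) :
    crossAxis i x = x (i + 1) • EuclideanSpace.single (i + 2) (1 : ℝ) -
      x (i + 2) • EuclideanSpace.single (i + 1) (1 : ℝ) := rfl

/-- Rodrigues' formula for the rotation by the angle `θ` about the `i`-th coordinate axis. -/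
def rotLinear (i : Fin 3) (θ : ℝ) : E3 →ₗ[ℝ] E3 :=
  LinearMap.id + Real.sin θ • crossAxis i + (1 - Real.cos θ) • (crossAxis i ∘ₗ crossAxis i)

lemma rotLinear_apply (i : Fin 3) (θ : ℝ) (x : E3) :
    rotLinear i θ x =
      x + Real.sin θ • crossAxis i x + (1 - Real.cos θ) • crossAxis i (crossAxis i x) := rfl

lemma rotLinear_apply_self (i : Fin 3) (θ : ℝ) (x : E3) : rotLinear i θ x i = x i := by
  fin_cases i <;> simp [rotLinear_apply, crossAxis_apply]

lemma rotLinear_apply_add_one (i : Fin 3) (θ : ℝ) (x : E3) :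
    rotLinear i θ x (i + 1) = Real.cos θ * x (i + 1) - Real.sin θ * x (i + 2) := by
  fin_cases i <;> simp [rotLinear_apply, crossAxis_apply] <;> ring

lemma rotLinear_apply_add_two (i : Fin 3) (θ : ℝ) (x : E3) :
    rotLinear i θ x (i + 2) = Real.sin θ * x (i + 1) + Real.cos θ * x (i + 2) := by
  fin_cases i <;> simp [rotLinear_apply, crossAxis_apply] <;> ring

lemma ext_axis {x y : E3} (i : Fin 3) (h0 : x i = y i) (h1 : x (i + 1) = y (i + 1))
    (h2 : x (i + 2) = y (i + 2)) : x = y := by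
  ext j
  have key : ∀ i j : Fin 3, j = i ∨ j = i + 1 ∨ j = i + 2 := by decide
  rcases key i j with rfl | rfl | rfl <;> assumption

lemma rotLinear_add (i : Fin 3) (θ η : ℝ) (x : E3) :
    rotLinear i θ (rotLinear i η x) = rotLinear i (θ + η) x := by
  refine ext_axis i ?_ ?_ ?_ <;>
    simp only [rotLinear_apply_self, rotLinear_apply_add_one, rotLinear_apply_add_two,
      Real.sin_add, Real.cos_add] <;> ring

lemma rotLinear_zero (i : Fin 3) (x : E3) : rotLinear i 0 x = x := by
  simp [rotLinear_apply]

lemma norm_rotLinear (i : Fin 3) (θ : ℝ) (x : E3) : ‖rotLinear i θ x‖ = ‖x‖ := by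
  have h : ∀ y : E3, ‖y‖ ^ 2 = y i ^ 2 + y (i + 1) ^ 2 + y (i + 2) ^ 2 := by
    intro y
    rw [EuclideanSpace.real_norm_sq_eq, Fin.sum_univ_three]
    fin_cases i <;> simp <;> ring
  rw [← sq_eq_sq₀ (norm_nonneg _) (norm_nonneg _), h, h, rotLinear_apply_self,
    rotLinear_apply_add_one, rotLinear_apply_add_two]
  linear_combination (x (i + 1) ^ 2 + x (i + 2) ^ 2) * Real.sin_sq_add_cos_sq θ

/-- The rotation by the angle `θ` about the `i`-th coordinate axis. -/
def rot (i : Fin 3) (θ : ℝ) : E3 ≃ₗᵢ[ℝ] E3 where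
  toLinearEquiv := LinearEquiv.ofLinearMap (rotLinear i θ) (rotLinear i (-θ))
    (by ext1 x; simp [rotLinear_add, rotLinear_zero])
    (by ext1 x; simp [rotLinear_add, rotLinear_zero])
  norm_map' := norm_rotLinear i θ

lemma rot_apply (i : Fin 3) (θ : ℝ) (x : E3) : rot i θ x = rotLinear i θ x := rfl

lemma sphereMap_rot_add (i : Fin 3) (θ η : ℝ) (x : S2) :
    sphereMap (rot i θ) (sphereMap (rot i η) x) = sphereMap (rot i (θ + η)) x := by
  ext1
  simp [rot_apply, rotLinear_add]

@[simp] lemma sphereMap_rot_zero (i : Fin 3) (x : S2) : sphereMap (rot i 0) x = x := by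
  ext1
  simp [rot_apply, rotLinear_zero]

/-- The symmetric second difference quotient of a function that is twice differentiable at the
origin tends to the second derivative. -/
lemma tendsto_second_difference {h h' : ℝ → ℂ} {c : ℂ}
    (hd : ∀ᶠ s in 𝓝 0, HasDerivAt h (h' s) s) (hd' : HasDerivAt h' c 0) :
    Tendsto (fun s : ℝ => ((s ^ 2)⁻¹ : ℝ) • (h s + h (-s) - 2 * h 0)) (𝓝[≠] 0) (𝓝 c) := by
  have ho := hd'.isLittleO
  rw [Metric.tendsto_nhdsWithin_nhds]
  intro ε hε
  have h1 := ho.def (c := ε / 4) (by positivity)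
  obtain ⟨δ, hδ, H⟩ := Metric.eventually_nhds_iff.1 (hd.and h1)
  refine ⟨δ, hδ, fun s hs hsδ => ?_⟩
  have hs0 : s ≠ 0 := hs
  have hsδ' : |s| < δ := by simpa [Real.dist_eq] using hsδ
  have H' : ∀ r : ℝ, |r| ≤ |s| → HasDerivAt h (h' r) r ∧ ‖h' r - h' 0 - (r : ℂ) * c‖ ≤ ε / 4 * |r| := by
    intro r hr
    have := H (y := r) (by simpa [Real.dist_eq] using hr.trans_lt hsδ')
    simpa using this
  -- the second difference minus its expected value has derivative `o(r)`, hence is `o(s ^ 2)`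
  let ψ : ℝ → ℂ := fun r => h r + h (-r) - 2 * h 0 - (r : ℂ) ^ 2 * c
  have hψ : ∀ r ∈ Metric.closedBall (0 : ℝ) |s|, HasDerivWithinAt ψ
      (h' r - h' (-r) - (2 * r) * c) (Metric.closedBall (0 : ℝ) |s|) r := by
    intro r hr
    have hr' : |r| ≤ |s| := by simpa using hr
    have d1 := (H' r hr').1
    have d2 : HasDerivAt (fun r => h (-r)) (-h' (-r)) r := by
      have d := (H' (-r) (by simpa using hr')).1.scomp r (hasDerivAt_neg r)
      rw [neg_smul, one_smul] at d
      exact d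
    have d3 : HasDerivAt (fun r : ℝ => (r : ℂ) ^ 2 * c) ((2 * r) * c) r := by
      have := ((Complex.ofRealCLM.hasDerivAt (x := r)).pow 2).mul_const c
      simpa using this
    have d := (((d1.fun_add d2).sub_const (2 * h 0)).fun_sub d3)
    rw [← sub_eq_add_neg] at d
    exact d.hasDerivWithinAt
  have hb : ∀ r ∈ Metric.closedBall (0 : ℝ) |s|, ‖h' r - h' (-r) - (2 * r) * c‖ ≤ ε / 2 * |s| := by
    intro r hr
    have hr' : |r| ≤ |s| := by simpa using hr
    have b1 := (H' r hr').2
    have b2 := (H' (-r) (by simpa using hr')).2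
    have e : h' r - h' (-r) - (2 * r) * c =
        (h' r - h' 0 - r * c) - (h' (-r) - h' 0 - ((-r : ℝ) : ℂ) * c) := by
      push_cast; ring
    rw [e]
    refine (norm_sub_le _ _).trans ?_
    rw [abs_neg] at b2
    nlinarith
  have := (convex_closedBall (0 : ℝ) |s|).norm_image_sub_le_of_norm_hasDerivWithin_le hψ hb
    (x := 0) (y := s) (by simp) (by simp)
  have hψ0 : ψ 0 = 0 := by simp [ψ]; ring
  rw [hψ0, sub_zero, sub_zero, Real.norm_eq_abs, mul_assoc, ← sq, sq_abs] at this
  have hs2 : 0 < s ^ 2 := by positivity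
  rw [dist_eq_norm]
  have e : ((s ^ 2)⁻¹ : ℝ) • (h s + h (-s) - 2 * h 0) - c = ((s ^ 2)⁻¹ : ℝ) • ψ s := by
    simp only [ψ, Complex.real_smul]
    push_cast
    have : (s : ℂ) ≠ 0 := by exact_mod_cast hs0
    field_simp
  rw [e, norm_smul, norm_inv, Real.norm_of_nonneg hs2.le, inv_mul_lt_iff₀ hs2]
  nlinarith

/-- The second derivative at the origin of a function along the circle
`s ↦ x + sin s • v + (1 - cos s) • w`. -/
lemma tendsto_second_difference_circle {F : E3 → ℂ} {x : E3} (hF : ContDiffAt ℝ 2 F x)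
    (v w : E3) :
    Tendsto (fun s : ℝ => ((s ^ 2)⁻¹ : ℝ) •
        (F (x + Real.sin s • v + (1 - Real.cos s) • w) +
          F (x + Real.sin (-s) • v + (1 - Real.cos (-s)) • w) - 2 * F x)) (𝓝[≠] 0)
      (𝓝 (fderiv ℝ (fderiv ℝ F) x v v + fderiv ℝ F x w)) := by
  let γ : ℝ → E3 := fun s => x + Real.sin s • v + (1 - Real.cos s) • w
  let γ' : ℝ → E3 := fun s => Real.cos s • v + Real.sin s • w
  have hγ : ∀ s, HasDerivAt γ (γ' s) s := by
    intro s
    have h1 := ((Real.hasDerivAt_sin s).smul_const v).const_add x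
    have h2 := ((Real.hasDerivAt_cos s).const_sub 1).smul_const w
    simpa [γ, γ'] using h1.fun_add h2
  have hγ' : HasDerivAt γ' w 0 := by
    have h1 := (Real.hasDerivAt_cos 0).smul_const v
    have h2 := (Real.hasDerivAt_sin 0).smul_const w
    simpa [γ'] using h1.fun_add h2
  have hγ0 : γ 0 = x := by simp [γ]
  have hγ'0 : γ' 0 = v := by simp [γ']
  have hdiff : ∀ᶠ y in 𝓝 x, DifferentiableAt ℝ F y :=
    (hF.eventually (by simp)).mono fun y hy => hy.differentiableAt (by norm_num)
  have hcont : Tendsto γ (𝓝 0) (𝓝 x) := by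
    have := (hγ 0).continuousAt.tendsto
    rwa [hγ0] at this
  have hd : ∀ᶠ s in 𝓝 0, HasDerivAt (F ∘ γ) (fderiv ℝ F (γ s) (γ' s)) s :=
    (hcont.eventually hdiff).mono fun s hs => hs.hasFDerivAt.comp_hasDerivAt s (hγ s)
  have hF' : DifferentiableAt ℝ (fderiv ℝ F) (γ 0) := by
    rw [hγ0]
    exact (hF.fderiv_right (m := 1) (by norm_num)).differentiableAt (by norm_num)
  have hd' : HasDerivAt (fun s => fderiv ℝ F (γ s) (γ' s))
      (fderiv ℝ (fderiv ℝ F) x v v + fderiv ℝ F x w) 0 := by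
    have h1 := hF'.hasFDerivAt.comp_hasDerivAt 0 (hγ 0)
    have h2 := h1.clm_apply hγ'
    simpa [hγ0, hγ'0] using h2
  have := tendsto_second_difference hd hd'
  simpa [γ] using this

/-- The vectors `eᵢ × x` satisfy `∑ i, (eᵢ × x) ⊗ (eᵢ × x) = ‖x‖ ^ 2 • 1 - x ⊗ x`. -/
lemma sum_bilinear_crossAxis (B : E3 →L[ℝ] E3 →L[ℝ] ℂ) (x : E3) :
    ∑ i, B (crossAxis i x) (crossAxis i x) =
      (‖x‖ ^ 2 : ℝ) • ∑ i, B (EuclideanSpace.single i 1) (EuclideanSpace.single i 1) - B x x := by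
  have hx : x = ∑ i, x i • EuclideanSpace.single i (1 : ℝ) := by
    ext j
    fin_cases j <;> simp [Fin.sum_univ_three]
  rw [EuclideanSpace.real_norm_sq_eq]
  conv_rhs => rw [hx]
  simp only [crossAxis_apply, Fin.sum_univ_three, map_add, map_sub, map_smul,
    add_apply, sub_apply, smul_apply,
    Complex.real_smul]
  simp
  ring

lemma sum_crossAxis_crossAxis (x : E3) : ∑ i, crossAxis i (crossAxis i x) = (-2 : ℝ) • x := by
  ext j
  fin_cases j <;> simp [Fin.sum_univ_three, crossAxis_apply] <;> ring

lemma fderiv_radialExtension_self {f : S2 → ℂ} (hf : IsSmooth f) {y : E3} (hy : y ≠ 0) :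
    fderiv ℝ (radialExtension f) y y = 0 := by
  have hd : DifferentiableAt ℝ (radialExtension f) y :=
    ((hf y hy).contDiffAt (isOpen_compl_singleton.mem_nhds hy)).differentiableAt (by simp)
  have h1 : HasDerivAt (fun r : ℝ => radialExtension f (r • y))
      (fderiv ℝ (radialExtension f) y y) 1 := by
    have hr : HasDerivAt (fun r : ℝ => r • y) y 1 := by
      simpa using (hasDerivAt_id (1 : ℝ)).smul_const y
    have hd' : HasFDerivAt (radialExtension f) (fderiv ℝ (radialExtension f) y) ((1 : ℝ) • y) := by
      simpa using hd.hasFDerivAt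
    exact hd'.comp_hasDerivAt 1 hr
  have h2 : (fun r : ℝ => radialExtension f (r • y)) =ᶠ[𝓝 1] fun _ => radialExtension f y := by
    filter_upwards [lt_mem_nhds (zero_lt_one' ℝ)] with r hr
    exact radialExtension_pos_smul f hr y
  exact h1.unique ((hasDerivAt_const 1 _).congr_of_eventuallyEq h2)

/-- Differentiating the relation `fderiv F y y = 0` at `y = x` in the direction `x`. -/
lemma fderiv_fderiv_radialExtension_self {f : S2 → ℂ} (hf : IsSmooth f)
    (x : S2) :
    fderiv ℝ (fderiv ℝ (radialExtension f)) x x x = 0 := by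
  have hx : (x : E3) ≠ 0 := ne_zero_of_mem_unit_sphere x
  have hF' : DifferentiableAt ℝ (fderiv ℝ (radialExtension f)) x :=
    ((hf.contDiffAt x).fderiv_right (m := 1) (by norm_num)).differentiableAt (by norm_num)
  have h1 := hF'.hasFDerivAt.clm_apply (hasFDerivAt_id (𝕜 := ℝ) (x : E3))
  have h2 : (fun y => fderiv ℝ (radialExtension f) y (id y)) =ᶠ[𝓝 (x : E3)] fun _ => 0 := by
    filter_upwards [isOpen_compl_singleton.mem_nhds hx] with y hy
    exact fderiv_radialExtension_self hf hy
  have h3 := h1.unique ((hasFDerivAt_const (0 : ℂ) (x : E3)).congr_of_eventuallyEq h2)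
  have h4 := DFunLike.congr_fun h3 (x : E3)
  simpa [fderiv_radialExtension_self hf hx] using h4

/-- The sum of the second differences along the rotations about the three coordinate axes tends to
the Laplace–Beltrami operator: it is the Casimir operator of the rotation group. -/
lemma tendsto_sum_second_difference {f : S2 → ℂ} (hf : IsSmooth f)
    (x : S2) :
    Tendsto (fun s : ℝ => ∑ i : Fin 3, ((s ^ 2)⁻¹ : ℝ) •
      (f (sphereMap (rot i s) x) + f (sphereMap (rot i (-s)) x) - 2 * f x)) (𝓝[≠] 0)
      (𝓝 (laplaceBeltrami f x)) := by
  have hx : (x : E3) ≠ 0 := ne_zero_of_mem_unit_sphere x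
  have h := tendsto_finsetSum Finset.univ fun (i : Fin 3) _ =>
    tendsto_second_difference_circle (hf.contDiffAt x) (crossAxis i x) (crossAxis i (crossAxis i x))
  have e : laplaceBeltrami f x = ∑ i, (fderiv ℝ (fderiv ℝ (radialExtension f)) x
      (crossAxis i x) (crossAxis i x) +
        fderiv ℝ (radialExtension f) x (crossAxis i (crossAxis i x))) := by
    rw [Finset.sum_add_distrib, sum_bilinear_crossAxis, ← map_sum, sum_crossAxis_crossAxis,
      map_smul, fderiv_radialExtension_self hf hx, fderiv_fderiv_radialExtension_self hf]
    unfold laplaceBeltrami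
    rw [congrFun (InnerProductSpace.laplacian_eq_iteratedFDeriv_orthonormalBasis _
      (EuclideanSpace.basisFun (Fin 3) ℝ)) (x : E3)]
    simp [iteratedFDeriv_two_apply]
  rw [e]
  refine h.congr fun s => Finset.sum_congr rfl fun i _ => ?_
  simp only [← radialExtension_coe f, coe_sphereMap, rot_apply, rotLinear_apply]

/-! ### Orthogonality of spherical harmonics and the size of rotations -/

/-- On the finite-dimensional space of spherical harmonics of degree `n`, pointwise convergence
implies convergence in the Hilbert space. -/
lemma tendsto_of_tendsto_rep {n : ℕ} [FiniteDimensional ℂ (harmonicSpace n)] {ι : Type*}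
    {l : Filter ι} {Φ : ι → harmonicSpace n} {φ : harmonicSpace n}
    (h : ∀ x, Tendsto (fun i => rep n (Φ i) x) l (𝓝 (rep n φ x))) : Tendsto Φ l (𝓝 φ) := by
  let E : harmonicSpace n →ₗ[ℂ] (S2 → ℂ) :=
    { toFun := fun φ => ⇑(rep n φ)
      map_add' := fun φ ψ => by simp
      map_smul' := fun c φ => by simp }
  have hE : E.ker = ⊥ := LinearMap.ker_eq_bot.2 fun φ ψ hφ =>
    rep_injective n (DFunLike.coe_injective hφ)
  rw [(LinearMap.isClosedEmbedding_of_injective hE).isInducing.tendsto_nhds_iff]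
  exact tendsto_pi_nhds.2 h

lemma coe_rotate {n : ℕ} (R : E3 ≃ₗᵢ[ℝ] E3) (φ : harmonicSpace n) :
    (rotate n R φ : L2S2) = rotateL2 R φ := rfl

lemma rotate_rot_add {n : ℕ} (i : Fin 3) (θ η : ℝ) (φ : harmonicSpace n) :
    rotate n (rot i θ) (rotate n (rot i η) φ) = rotate n (rot i (θ + η)) φ :=
  harmonic_ext fun x => by simp [sphereMap_rot_add, add_comm]

@[simp] lemma rotate_rot_zero {n : ℕ} (i : Fin 3) (φ : harmonicSpace n) :
    rotate n (rot i 0) φ = φ :=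
  harmonic_ext fun x => by simp

lemma inner_rotate_neg {n m : ℕ} (i : Fin 3) (s : ℝ) (φ : harmonicSpace n)
    (ψ : harmonicSpace m) :
    inner ℂ (rotate n (rot i (-s)) φ : L2S2) (ψ : L2S2) =
      inner ℂ (φ : L2S2) (rotate m (rot i s) ψ : L2S2) := by
  rw [← (rotateL2 (rot i s)).inner_map_map, ← coe_rotate, rotate_rot_add]
  simp [coe_rotate]

/-- The sum of the symmetric second difference quotients along the rotations about the three
coordinate axes. -/
def casimirDiff (n : ℕ) (s : ℝ) (φ : harmonicSpace n) : harmonicSpace n :=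
  (((s ^ 2)⁻¹ : ℝ) : ℂ) • ∑ i : Fin 3,
    (rotate n (rot i s) φ + rotate n (rot i (-s)) φ - (2 : ℂ) • φ)

lemma inner_casimirDiff {n m : ℕ} (s : ℝ) (φ : harmonicSpace n) (ψ : harmonicSpace m) :
    inner ℂ (casimirDiff n s φ : L2S2) (ψ : L2S2) =
      inner ℂ (φ : L2S2) (casimirDiff m s ψ : L2S2) := by
  have h : ∀ i : Fin 3,
      inner ℂ ((rotate n (rot i s) φ + rotate n (rot i (-s)) φ - (2 : ℂ) • φ : harmonicSpace n) :
        L2S2) (ψ : L2S2) =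
      inner ℂ (φ : L2S2) ((rotate m (rot i s) ψ + rotate m (rot i (-s)) ψ - (2 : ℂ) • ψ :
        harmonicSpace m) : L2S2) := by
    intro i
    have h1 := inner_rotate_neg i s φ ψ
    have h2 := inner_rotate_neg i (-s) φ ψ
    rw [neg_neg] at h2
    simp only [Submodule.coe_sub, Submodule.coe_add, Submodule.coe_smul, inner_sub_left,
      inner_sub_right, inner_add_left, inner_add_right, inner_smul_left, inner_smul_right, h1, h2]
    rw [map_ofNat]
    ring
  simp only [casimirDiff, Submodule.coe_smul, Submodule.coe_sum, inner_smul_left,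
    inner_smul_right, Complex.conj_ofReal, sum_inner, inner_sum, h]

/-- The limit holds pointwise, and therefore in the Hilbert space because the spherical harmonics of
degree `n` form a finite-dimensional space. -/
lemma tendsto_casimirDiff {n : ℕ} [FiniteDimensional ℂ (harmonicSpace n)] (φ : harmonicSpace n) :
    Tendsto (fun s => casimirDiff n s φ) (𝓝[≠] 0) (𝓝 (-((n : ℂ) * ((n : ℂ) + 1)) • φ)) := by
  refine tendsto_of_tendsto_rep fun x => ?_
  have h := tendsto_sum_second_difference (isSmooth_rep φ) x
  have e : laplaceBeltrami (rep n φ) x = rep n (-((n : ℂ) * ((n : ℂ) + 1)) • φ) x := by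
    rw [map_smul, ContinuousMap.smul_apply, smul_eq_mul, neg_mul, ← laplaceBeltrami_rep, neg_neg]
  rw [← e]
  refine h.congr fun s => ?_
  rw [casimirDiff, map_smul, map_sum, ContinuousMap.smul_apply, ContinuousMap.sum_apply, ← Finset.smul_sum,
    Complex.real_smul, smul_eq_mul]
  simp

/-- The second differences are symmetric and tend to distinct scalars on the two spaces. -/
lemma harmonicSpace_orthogonal {n m : ℕ} [FiniteDimensional ℂ (harmonicSpace n)]
    [FiniteDimensional ℂ (harmonicSpace m)] (hnm : n ≠ m) (φ : harmonicSpace n)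
    (ψ : harmonicSpace m) : inner ℂ (φ : L2S2) (ψ : L2S2) = 0 := by
  have h1 : Tendsto (fun s => inner ℂ (casimirDiff n s φ : L2S2) (ψ : L2S2)) (𝓝[≠] 0) _ :=
    ((continuous_subtype_val.tendsto _).comp (tendsto_casimirDiff φ)).inner tendsto_const_nhds
  have h2 : Tendsto (fun s => inner ℂ (φ : L2S2) (casimirDiff m s ψ : L2S2)) (𝓝[≠] 0) _ :=
    tendsto_const_nhds.inner ((continuous_subtype_val.tendsto _).comp (tendsto_casimirDiff ψ))
  simp only [inner_casimirDiff] at h1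
  have h3 := tendsto_nhds_unique h1 h2
  simp only [Submodule.coe_smul, inner_smul_left, inner_smul_right, map_neg, map_mul, map_add,
    Complex.conj_natCast, map_one] at h3
  have h4 : ((n : ℂ) * (n + 1) - m * (m + 1)) * inner ℂ (φ : L2S2) (ψ : L2S2) = 0 := by
    linear_combination -h3
  refine (mul_eq_zero.1 h4).resolve_left fun h => hnm ?_
  have h5 : (n : ℂ) * (n + 1) = m * (m + 1) := sub_eq_zero.1 h
  have h6 : n * (n + 1) = m * (m + 1) := by exact_mod_cast h5
  rcases lt_trichotomy n m with h7 | h7 | h7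
  · nlinarith
  · exact h7
  · nlinarith

/-- Each of the three second differences contributes `-‖R φ - φ‖ ^ 2 / s ^ 2` to the quadratic form
of their sum, where `R` is the rotation by the angle `s`. -/
lemma norm_rotate_sub_sq_le {n : ℕ} {s : ℝ} (hs : s ≠ 0) (i : Fin 3) (φ : harmonicSpace n) :
    ‖rotate n (rot i s) φ - φ‖ ^ 2 ≤
      s ^ 2 * -(inner ℂ (casimirDiff n s φ : L2S2) (φ : L2S2)).re := by
  have hs2 : 0 < s ^ 2 := by positivity
  have h : ∀ j : Fin 3, ‖rotate n (rot j s) φ - φ‖ ^ 2 =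
      -(inner ℂ ((rotate n (rot j s) φ + rotate n (rot j (-s)) φ - (2 : ℂ) • φ :
        harmonicSpace n) : L2S2) (φ : L2S2)).re := by
    intro j
    have h1 := inner_rotate_neg j s φ φ
    have h2 : (inner ℂ (φ : L2S2) (rotate n (rot j s) φ : L2S2)).re =
        (inner ℂ (rotate n (rot j s) φ : L2S2) (φ : L2S2)).re := inner_re_symm (𝕜 := ℂ) _ _
    have h3 : (inner ℂ (φ : L2S2) (φ : L2S2)).re = ‖φ‖ ^ 2 := inner_self_eq_norm_sq (𝕜 := ℂ) _
    have h4 : ‖(rotate n (rot j s) φ : L2S2)‖ = ‖φ‖ := (rotate n (rot j s)).norm_map φ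
    rw [Submodule.coe_norm, Submodule.coe_sub, @norm_sub_sq ℂ, h4, Submodule.coe_sub,
      Submodule.coe_add, Submodule.coe_smul, inner_sub_left, inner_add_left, h1, inner_smul_left,
      ← Submodule.coe_norm]
    simp only [RCLike.re_to_complex, Complex.sub_re, Complex.add_re, h2, map_ofNat, Complex.mul_re,
      h3, Complex.re_ofNat, Complex.im_ofNat]
    ring
  rw [casimirDiff, Submodule.coe_smul, Submodule.coe_sum, inner_smul_left, sum_inner,
    Complex.conj_ofReal, Complex.re_ofReal_mul, Complex.re_sum, ← mul_neg, ← mul_assoc,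
    mul_inv_cancel₀ hs2.ne', one_mul, ← Finset.sum_neg_distrib]
  simp only [← h]
  exact Finset.single_le_sum (f := fun j => ‖rotate n (rot j s) φ - φ‖ ^ 2)
    (fun j _ => sq_nonneg _) (Finset.mem_univ i)

lemma norm_rotate_sub_le_two_pow {n : ℕ} (i : Fin 3) (φ : harmonicSpace n) (k : ℕ) (θ : ℝ) :
    ‖rotate n (rot i θ) φ - φ‖ ≤ 2 ^ k * ‖rotate n (rot i (θ / 2 ^ k)) φ - φ‖ := by
  induction k with
  | zero => simp
  | succ k ih =>
    refine ih.trans ?_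
    set η := θ / 2 ^ (k + 1) with hη
    have e : θ / 2 ^ k = η + η := by rw [hη, pow_succ]; field_simp; norm_num
    -- `R² φ - φ = R (R φ - φ) + (R φ - φ)` for the rotation `R` by the angle `η`
    have e2 : rotate n (rot i (η + η)) φ - φ =
        rotate n (rot i η) (rotate n (rot i η) φ - φ) + (rotate n (rot i η) φ - φ) := by
      rw [map_sub, rotate_rot_add]; abel
    rw [e, e2, pow_succ, mul_assoc]
    gcongr
    refine (norm_add_le _ _).trans ?_
    rw [(rotate n (rot i η)).norm_map]
    linarith

/-- A rotation about a coordinate axis moves a spherical harmonic of degree `n` by at most `n + 1`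
times the angle and the norm. Iterating the triangle inequality reduces this to infinitesimal
angles, where it holds because the three second differences are nonpositive operators whose sum
tends to `-n (n + 1)`. -/
lemma norm_rotate_sub_le {n : ℕ} [FiniteDimensional ℂ (harmonicSpace n)] (i : Fin 3) (θ : ℝ)
    (φ : harmonicSpace n) :
    ‖rotate n (rot i θ) φ - φ‖ ≤ ((n : ℝ) + 1) * |θ| * ‖φ‖ := by
  rcases eq_or_ne θ 0 with rfl | hθ
  · simp
  have hlim : Tendsto (fun k : ℕ => θ / 2 ^ k) atTop (𝓝[≠] 0) := by
    refine tendsto_nhdsWithin_iff.2 ⟨?_, Eventually.of_forall fun k => ?_⟩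
    · have := (tendsto_pow_atTop_nhds_zero_of_lt_one (r := (1 / 2 : ℝ)) (by norm_num)
        (by norm_num)).const_mul θ
      simpa [div_eq_mul_inv] using this
    · simp [hθ]
  have hc : Tendsto (fun k : ℕ => θ ^ 2 *
      -(inner ℂ (casimirDiff n (θ / 2 ^ k) φ : L2S2) (φ : L2S2)).re) atTop
      (𝓝 (θ ^ 2 * -(inner ℂ ((-((n : ℂ) * ((n : ℂ) + 1)) • φ : harmonicSpace n) : L2S2)
        (φ : L2S2)).re)) := by
    have h1 := ((continuous_subtype_val.tendsto _).comp
      ((tendsto_casimirDiff φ).comp hlim)).inner (tendsto_const_nhds (x := (φ : L2S2))) (𝕜 := ℂ)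
    exact ((Complex.continuous_re.tendsto _).comp h1).neg.const_mul _
  have h := ge_of_tendsto' hc (b := ‖rotate n (rot i θ) φ - φ‖ ^ 2) fun k => by
    have h1 := norm_rotate_sub_le_two_pow i φ k θ
    have h2 := norm_rotate_sub_sq_le (s := θ / 2 ^ k) (by positivity) i φ
    calc ‖rotate n (rot i θ) φ - φ‖ ^ 2
        ≤ (2 ^ k * ‖rotate n (rot i (θ / 2 ^ k)) φ - φ‖) ^ 2 := by gcongr
      _ = (2 ^ k) ^ 2 * ‖rotate n (rot i (θ / 2 ^ k)) φ - φ‖ ^ 2 := by ring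
      _ ≤ (2 ^ k) ^ 2 * ((θ / 2 ^ k) ^ 2 *
            -(inner ℂ (casimirDiff n (θ / 2 ^ k) φ : L2S2) (φ : L2S2)).re) := by gcongr
      _ = _ := by field_simp
  have h3 : (inner ℂ ((-((n : ℂ) * ((n : ℂ) + 1)) • φ : harmonicSpace n) : L2S2)
      (φ : L2S2)).re = -((n : ℝ) * (n + 1) * ‖φ‖ ^ 2) := by
    rw [Submodule.coe_smul, inner_smul_left, inner_self_eq_norm_sq_to_K, Submodule.coe_norm]
    have h4 : (((‖(φ : L2S2)‖ : ℝ) : ℂ) ^ 2).re = ‖(φ : L2S2)‖ ^ 2 := by norm_cast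
    rw [← h4, ← Complex.re_ofReal_mul, ← Complex.neg_re]
    congr 1
    simp
  rw [h3, neg_neg] at h
  refine le_of_sq_le_sq (h.trans ?_) (by positivity)
  rw [mul_pow, mul_pow, sq_abs]
  have : 0 ≤ θ ^ 2 * ‖φ‖ ^ 2 := by positivity
  have hn : (0 : ℝ) ≤ n := n.cast_nonneg
  nlinarith

/-! ### Pointwise bounds for spherical harmonics -/

section Functional

variable {E ι : Type*} [NormedAddCommGroup E] [InnerProductSpace ℂ E] [Fintype ι]

lemma exists_inner_eq (b : OrthonormalBasis ι ℂ E) (ℓ : E →ₗ[ℂ] ℂ) :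
    ∃ v : E, (∀ w, ℓ w = inner ℂ v w) ∧ ‖v‖ ^ 2 = ∑ k, ‖ℓ (b k)‖ ^ 2 := by
  have : FiniteDimensional ℂ E := Module.Finite.of_basis b.toBasis
  have : CompleteSpace E := FiniteDimensional.complete ℂ E
  let v := (InnerProductSpace.toDual ℂ E).symm (LinearMap.toContinuousLinearMap ℓ)
  have hv : ∀ w, ℓ w = inner ℂ v w := fun w => by
    rw [InnerProductSpace.toDual_symm_apply]; rfl
  refine ⟨v, hv, ?_⟩
  rw [← b.sum_sq_norm_inner_left v]
  simp only [hv]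

lemma norm_functional_le (b : OrthonormalBasis ι ℂ E) (ℓ : E →ₗ[ℂ] ℂ) (w : E) :
    ‖ℓ w‖ ^ 2 ≤ (∑ k, ‖ℓ (b k)‖ ^ 2) * ‖w‖ ^ 2 := by
  obtain ⟨v, hv, hv'⟩ := exists_inner_eq b ℓ
  rw [← hv', hv, ← mul_pow]
  gcongr
  exact norm_inner_le_norm v w

lemma sum_norm_functional_comp (b : OrthonormalBasis ι ℂ E) (ℓ : E →ₗ[ℂ] ℂ) (U : E →ₗᵢ[ℂ] E) :
    ∑ k, ‖ℓ (U (b k))‖ ^ 2 = ∑ k, ‖ℓ (b k)‖ ^ 2 := by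
  have : FiniteDimensional ℂ E := Module.Finite.of_basis b.toBasis
  obtain ⟨v, hv, hv'⟩ := exists_inner_eq b ℓ
  rw [← hv', ← (b.map (U.toLinearIsometryEquiv rfl)).sum_sq_norm_inner_left v]
  simp [hv]

end Functional

/-- Evaluation of spherical harmonics of degree `n` at a point. -/
def evalAt (n : ℕ) (x : S2) : harmonicSpace n →ₗ[ℂ] ℂ where
  toFun φ := rep n φ x
  map_add' φ ψ := by simp
  map_smul' c φ := by simp

/-- The addition theorem on the diagonal: the sum of the squares of an orthonormal basis of
spherical harmonics is constant, because it is invariant under rotations. -/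
lemma sum_norm_sq_rep {n : ℕ} {ι : Type*} [Fintype ι]
    (b : OrthonormalBasis ι ℂ (harmonicSpace n)) (x : S2) :
    ∑ k, ‖rep n (b k) x‖ ^ 2 = Fintype.card ι := by
  have hc : ∀ y, ∑ k, ‖rep n (b k) y‖ ^ 2 = ∑ k, ‖rep n (b k) x‖ ^ 2 := fun y => by
    obtain ⟨R, rfl⟩ := exists_sphereMap_eq x y
    have h := sum_norm_functional_comp b (evalAt n x) (rotate n R)
    simpa [evalAt] using h
  have h1 : ∫ y, ∑ k, ‖rep n (b k) y‖ ^ 2 ∂sphereMeasure = ∑ k, ‖rep n (b k) x‖ ^ 2 := by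
    simp only [hc, integral_const, probReal_univ, one_smul]
  have h2 : ∀ k : ι, Integrable (fun y => ‖rep n (b k) y‖ ^ 2) sphereMeasure := fun k =>
    ((rep n (b k)).continuous.norm.pow 2).integrable_of_hasCompactSupport
      (HasCompactSupport.of_compactSpace _)
  rw [← h1, integral_finsetSum _ fun k _ => h2 k]
  have hb : ∀ k, ‖b k‖ = 1 := b.orthonormal.1
  simp [← norm_sq_eq_integral_rep, hb]

lemma norm_rep_le {n : ℕ} [FiniteDimensional ℂ (harmonicSpace n)]
    (hn : Module.finrank ℂ (harmonicSpace n) = 2 * n + 1) (φ : harmonicSpace n) (x : S2) :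
    ‖rep n φ x‖ ≤ ((n : ℝ) + 1) * ‖φ‖ := by
  have h1 := sum_norm_sq_rep (stdOrthonormalBasis ℂ (harmonicSpace n)) x
  rw [Fintype.card_fin] at h1
  have h2 : ‖rep n φ x‖ ^ 2 ≤ _ :=
    norm_functional_le (stdOrthonormalBasis ℂ (harmonicSpace n)) (evalAt n x) φ
  have h3 : ∑ k, ‖evalAt n x (stdOrthonormalBasis ℂ (harmonicSpace n) k)‖ ^ 2 =
    ((2 * n + 1 : ℕ) : ℝ) := h1.trans (congrArg Nat.cast hn)
  rw [h3] at h2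
  refine le_of_sq_le_sq (h2.trans ?_) (by positivity)
  rw [mul_pow]
  gcongr
  push_cast
  nlinarith [n.cast_nonneg (α := ℝ)]

lemma norm_rep_rot_sub_le {n : ℕ} [FiniteDimensional ℂ (harmonicSpace n)]
    (hn : Module.finrank ℂ (harmonicSpace n) = 2 * n + 1) (φ : harmonicSpace n) (i : Fin 3)
    (θ η : ℝ) (x : S2) :
    ‖rep n φ (sphereMap (rot i θ) x) - rep n φ (sphereMap (rot i η) x)‖ ≤
      ((n : ℝ) + 1) ^ 2 * |θ - η| * ‖φ‖ := by
  have e : rep n φ (sphereMap (rot i θ) x) - rep n φ (sphereMap (rot i η) x) =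
      rep n (rotate n (rot i (θ - η)) φ - φ) (sphereMap (rot i η) x) := by
    simp [sphereMap_rot_add]
  rw [e]
  refine (norm_rep_le hn _ _).trans ?_
  calc ((n : ℝ) + 1) * ‖rotate n (rot i (θ - η)) φ - φ‖
      ≤ ((n : ℝ) + 1) * (((n : ℝ) + 1) * |θ - η| * ‖φ‖) := by
        gcongr; exact norm_rotate_sub_le i _ φ
    _ = _ := by ring

/-- The point of the sphere with polar angle `θ` and azimuth `η`. -/
def spherePoint (θ η : ℝ) : S2 :=
  sphereMap (rot 2 η) (sphereMap (rot 1 θ) ⟨EuclideanSpace.single 2 1, by simp⟩)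

lemma exists_spherePoint_eq (x : S2) :
    ∃ θ η : ℝ, |θ| ≤ Real.pi ∧ |η| ≤ Real.pi ∧ spherePoint θ η = x := by
  have hx : (x : E3) 0 ^ 2 + (x : E3) 1 ^ 2 + (x : E3) 2 ^ 2 = 1 := by
    have h := EuclideanSpace.real_norm_sq_eq (x : E3)
    rw [Fin.sum_univ_three] at h
    rw [← h]; simp
  let z : ℂ := ⟨(x : E3) 0, (x : E3) 1⟩
  have hz : Real.sin (Real.arccos ((x : E3) 2)) = ‖z‖ := by
    rw [Real.sin_arccos, Complex.norm_def, Complex.normSq_mk]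
    congr 1
    linarith
  have hc : Real.cos (Real.arccos ((x : E3) 2)) = (x : E3) 2 :=
    Real.cos_arccos (by nlinarith) (by nlinarith)
  refine ⟨Real.arccos ((x : E3) 2), z.arg, ?_, Complex.abs_arg_le_pi z, ?_⟩
  · rw [abs_of_nonneg (Real.arccos_nonneg _)]
    exact Real.arccos_le_pi _
  · have h0 : ‖z‖ * Real.cos z.arg = (x : E3) 0 := Complex.norm_mul_cos_arg z
    have h1 : ‖z‖ * Real.sin z.arg = (x : E3) 1 := Complex.norm_mul_sin_arg z
    ext j
    fin_cases j <;>
      simp [spherePoint, rot_apply, rotLinear_apply, crossAxis_apply, hz, hc]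
    · linarith
    · linarith

lemma norm_rep_spherePoint_sub_le {n : ℕ} [FiniteDimensional ℂ (harmonicSpace n)]
    (hn : Module.finrank ℂ (harmonicSpace n) = 2 * n + 1) (φ : harmonicSpace n)
    (θ θ' η η' : ℝ) :
    ‖rep n φ (spherePoint θ η) - rep n φ (spherePoint θ' η')‖ ≤
      ((n : ℝ) + 1) ^ 2 * (|θ - θ'| + |η - η'|) * ‖φ‖ := by
  have h1 := norm_rep_rot_sub_le hn φ 2 η η' (sphereMap (rot 1 θ) ⟨EuclideanSpace.single 2 1, by simp⟩)
  have h2 := norm_rep_rot_sub_le hn (rotate n (rot 2 η') φ) 1 θ θ'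
    ⟨EuclideanSpace.single 2 1, by simp⟩
  rw [rep_rotate, rep_rotate, (rotate n _).norm_map] at h2
  refine (norm_sub_le_norm_sub_add_norm_sub _ (rep n φ (spherePoint θ η')) _).trans ?_
  refine (add_le_add h1 h2).trans (le_of_eq ?_)
  ring

/-! ### Spectral projections and the Schrödinger flow -/

lemma topologicalClosure_harmonicSpace (n : ℕ) [FiniteDimensional ℂ (harmonicSpace n)] :
    (harmonicSpace n).topologicalClosure = harmonicSpace n :=
  (Submodule.closed_of_finiteDimensional _).submodule_topologicalClosure_eq

lemma spectralProjection_mem (n : ℕ) [FiniteDimensional ℂ (harmonicSpace n)] (φ : L2S2) :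
    spectralProjection n φ ∈ harmonicSpace n := by
  rw [← topologicalClosure_harmonicSpace n]
  exact Submodule.starProjection_apply_mem _ φ

lemma inner_sub_spectralProjection (n : ℕ) (φ : L2S2) (ψ : harmonicSpace n) :
    inner ℂ (φ - spectralProjection n φ) (ψ : L2S2) = 0 :=
  Submodule.starProjection_inner_eq_zero φ _ (Submodule.le_topologicalClosure _ ψ.2)

lemma spectralProjection_eq {n : ℕ} {φ : L2S2} (ψ : harmonicSpace n)
    (h : ∀ χ : harmonicSpace n, inner ℂ (φ - ψ : L2S2) (χ : L2S2) = 0) :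
    spectralProjection n φ = ψ := by
  refine (Submodule.eq_starProjection_of_mem_of_inner_eq_zero
    (Submodule.le_topologicalClosure _ ψ.2) fun w hw => ?_)
  have hc : IsClosed {w : L2S2 | inner ℂ (φ - ψ : L2S2) w = 0} :=
    isClosed_eq (by fun_prop) continuous_const
  exact closure_minimal (s := (harmonicSpace n : Set L2S2)) (fun χ hχ => h ⟨χ, hχ⟩) hc hw

/-- The factor by which the flow at time `t` multiplies spherical harmonics of degree `n`. -/
def phase (n : ℕ) (t : ℝ) : ℂ :=
  Complex.exp (-(Complex.I * (t : ℂ) * ((n : ℂ) * ((n : ℂ) + 1))))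

lemma phase_eq (n : ℕ) (t : ℝ) :
    phase n t = Complex.exp (((-(t * (n * (n + 1))) : ℝ) : ℂ) * Complex.I) := by
  unfold phase
  congr 1
  push_cast
  ring

@[simp] lemma norm_phase (n : ℕ) (t : ℝ) : ‖phase n t‖ = 1 := by
  rw [phase_eq, Complex.norm_exp_ofReal_mul_I]

@[simp] lemma phase_zero (n : ℕ) : phase n 0 = 1 := by simp [phase]

lemma continuous_phase (n : ℕ) : Continuous (phase n) := by
  unfold phase
  fun_prop

/-- The degrees `n` with `2 ^ j ≤ n + 1 < 2 ^ (j + 1)`. -/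
def dyadicBlock (j : ℕ) : Finset ℕ := Finset.Ico (2 ^ j - 1) (2 ^ (j + 1) - 1)

lemma sum_dyadicBlock {M : Type*} [AddCommMonoid M] (f : ℕ → M) (N : ℕ) :
    ∑ j ∈ Finset.range N, ∑ n ∈ dyadicBlock j, f n = ∑ n ∈ Finset.range (2 ^ N - 1), f n := by
  induction N with
  | zero => simp
  | succ N ih =>
    rw [Finset.sum_range_succ, ih, dyadicBlock, Finset.range_eq_Ico, Finset.range_eq_Ico,
      Finset.sum_Ico_consecutive _ (Nat.zero_le _)]
    exact Nat.sub_le_sub_right (Nat.pow_le_pow_right (by norm_num) N.le_succ) 1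

lemma sum_smul_coe_ae_eq (s : Finset ℕ) (c : ℕ → ℂ) (φ : ∀ n, harmonicSpace n) :
    (∑ n ∈ s, c n • (φ n : L2S2) : L2S2) =ᵐ[sphereMeasure]
      fun x => ∑ n ∈ s, c n * rep n (φ n) x := by
  refine (Lp.coeFn_finsetSum s _).trans ?_
  have h : ∀ᵐ x ∂sphereMeasure, ∀ n, (c n • (φ n : L2S2) : L2S2) x = c n * rep n (φ n) x :=
    ae_all_iff.2 fun n => by
      filter_upwards [Lp.coeFn_smul (c n) (φ n : L2S2), coeFn_ae_eq_rep (φ n)] with x h1 h2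
      rw [h1, Pi.smul_apply, h2, smul_eq_mul]
  filter_upwards [h] with x hx
  rw [Finset.sum_apply]
  exact Finset.sum_congr rfl fun n _ => hx n

section Components

variable [∀ n, FiniteDimensional ℂ (harmonicSpace n)]

/-- The component of degree `n` of a function on the sphere. -/
def component (n : ℕ) (φ : L2S2) : harmonicSpace n :=
  ⟨spectralProjection n φ, spectralProjection_mem n φ⟩

lemma coe_component (n : ℕ) (φ : L2S2) : (component n φ : L2S2) = spectralProjection n φ := rfl

lemma continuous_component (n : ℕ) : Continuous (component n) :=
  (spectralProjection n).continuous.subtype_mk _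

lemma orthogonalFamily_harmonicSpace :
    OrthogonalFamily ℂ (fun n => harmonicSpace n) fun n => (harmonicSpace n).subtypeₗᵢ :=
  fun _ _ hnm φ ψ => harmonicSpace_orthogonal hnm φ ψ

lemma sum_norm_sq_component_le (φ : L2S2) (s : Finset ℕ) :
    ∑ n ∈ s, ‖component n φ‖ ^ 2 ≤ ‖φ‖ ^ 2 := by
  set S : L2S2 := ∑ n ∈ s, (component n φ : L2S2) with hS
  have h1 : ‖S‖ ^ 2 = ∑ n ∈ s, ‖component n φ‖ ^ 2 :=
    orthogonalFamily_harmonicSpace.norm_sum (fun n => component n φ) s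
  have h2 : inner ℂ φ S = ((∑ n ∈ s, ‖component n φ‖ ^ 2 : ℝ) : ℂ) := by
    rw [hS, inner_sum, Complex.ofReal_sum]
    refine Finset.sum_congr rfl fun n _ => ?_
    have h := inner_sub_spectralProjection n φ (component n φ)
    rw [inner_sub_left, sub_eq_zero, ← coe_component, inner_self_eq_norm_sq_to_K] at h
    rw [h, Submodule.coe_norm]
    norm_cast
  have h3 : ‖S‖ ^ 2 ≤ ‖φ‖ * ‖S‖ := by
    have h := norm_inner_le_norm (𝕜 := ℂ) φ S
    rw [h2, ← h1, Complex.norm_real, Real.norm_of_nonneg (sq_nonneg _)] at h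
    exact h
  rw [← h1]
  have h4 : ‖S‖ ≤ ‖φ‖ := by
    by_contra! h
    nlinarith [norm_nonneg φ, norm_nonneg S]
  gcongr

lemma summable_norm_sq_component (φ : L2S2) : Summable fun n => ‖component n φ‖ ^ 2 :=
  summable_of_sum_le (fun _ => sq_nonneg _) fun s => sum_norm_sq_component_le φ s

lemma hasSum_schrodingerFlow (t : ℝ) (φ : L2S2) :
    HasSum (fun n => phase n t • (component n φ : L2S2)) (schrodingerFlow t φ) := by
  refine Summable.hasSum ?_
  have h := (orthogonalFamily_harmonicSpace.summable_iff_norm_sq_summable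
    (fun n => phase n t • component n φ)).2 ?_
  · exact h
  · simpa only [norm_smul, norm_phase, one_mul] using summable_norm_sq_component φ

/-! ### Dyadic blocks -/

/-- The part of the Schrödinger flow with degrees in the `j`-th dyadic block, as a continuous
function of time and space. -/
def blockFlow (φ : L2S2) (j : ℕ) (t : ℝ) (x : S2) : ℂ :=
  ∑ n ∈ dyadicBlock j, phase n t * rep n (component n φ) x

/-- The supremum over time and space of a dyadic block of the Schrödinger flow. -/
def blockSup (φ : L2S2) (j : ℕ) : ℝ≥0∞ := ⨆ p : ℝ × S2, ‖blockFlow φ j p.1 p.2‖ₑ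

lemma continuous_blockFlow (φ : L2S2) (j : ℕ) :
    Continuous fun p : ℝ × S2 => blockFlow φ j p.1 p.2 := by
  unfold blockFlow
  refine continuous_finsetSum _ fun n _ => ?_
  exact ((continuous_phase n).comp continuous_fst).mul
    ((rep n (component n φ)).continuous.comp continuous_snd)

lemma continuous_rep_component (n : ℕ) (x : S2) :
    Continuous fun φ : L2S2 => rep n (component n φ) x :=
  (LinearMap.continuous_of_finiteDimensional (evalAt n x)).comp (continuous_component n)

/-- The supremum is over an uncountable set, but of continuous functions of `φ`. -/
lemma measurable_blockSup (j : ℕ) : Measurable fun φ : L2S2 => blockSup φ j := by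
  refine LowerSemicontinuous.measurable (lowerSemicontinuous_iSup fun p => ?_)
  refine Continuous.lowerSemicontinuous (Continuous.enorm ?_)
  unfold blockFlow
  exact continuous_finsetSum _ fun n _ => continuous_const.mul (continuous_rep_component n p.2)

/-- The functions for which the suprema of the dyadic blocks of the Schrödinger flow are summable
and which are the sum of their components, the latter being the flow at time `0`. Both conditions
are Borel, so that they can be transferred between the probability space and the law of the data. -/
def goodSet : Set L2S2 :=
  {φ | ∑' j, blockSup φ j ≠ ∞} ∩ {φ | schrodingerFlow 0 φ - φ = 0}

lemma measurableSet_goodSet : MeasurableSet goodSet := by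
  refine MeasurableSet.inter ?_ ?_
  · exact (Measurable.tsum measurable_blockSup) (measurableSet_singleton ∞).compl
  · have h : Measurable fun φ : L2S2 => schrodingerFlow 0 φ - φ := by
      refine measurable_of_tendsto_metrizable
        (f := fun N φ => (∑ n ∈ Finset.range N, phase n 0 • (component n φ : L2S2)) - φ)
        (fun N => Continuous.measurable ?_) ?_
      · refine (continuous_finsetSum _ fun n _ => ?_).sub continuous_id
        exact (continuous_subtype_val.comp (continuous_component n)).const_smul (phase n 0)
      · exact tendsto_pi_nhds.2 fun φ =>
          (hasSum_schrodingerFlow 0 φ).tendsto_sum_nat.sub_const φ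
    exact h (measurableSet_singleton 0)

lemma norm_blockFlow_le {φ : L2S2} {j : ℕ} (h : blockSup φ j ≠ ∞) (t : ℝ) (x : S2) :
    ‖blockFlow φ j t x‖ ≤ (blockSup φ j).toReal := by
  rw [← toReal_enorm]
  exact ENNReal.toReal_mono h (le_iSup (fun p : ℝ × S2 => ‖blockFlow φ j p.1 p.2‖ₑ) (t, x))

/-- If the suprema of the dyadic blocks are summable, then the sum of the blocks is a continuous
version of the Schrödinger flow. -/
lemma isContinuousVersion_tsum_blockFlow {φ : L2S2} (h : ∑' j, blockSup φ j ≠ ∞) :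
    IsContinuousVersion φ fun t x => ∑' j, blockFlow φ j t x := by
  have hfin : ∀ j, blockSup φ j ≠ ∞ := ENNReal.ne_top_of_tsum_ne_top h
  have hsum : Summable fun j => (blockSup φ j).toReal := ENNReal.summable_toReal h
  refine ⟨continuous_tsum (continuous_blockFlow φ) hsum fun j p =>
    norm_blockFlow_le (hfin j) p.1 p.2, fun t => ?_⟩
  have hlim : Tendsto (fun N : ℕ => 2 ^ N - 1) atTop atTop :=
    (tendsto_sub_atTop_nat 1).comp (tendsto_pow_atTop_atTop_of_one_lt (by norm_num))
  obtain ⟨ns, hns, hae⟩ := (tendstoInMeasure_of_tendsto_Lp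
    ((hasSum_schrodingerFlow t φ).tendsto_sum_nat.comp hlim)).exists_seq_tendsto_ae
  have hrep : ∀ᵐ x ∂sphereMeasure, ∀ N : ℕ,
      (∑ n ∈ Finset.range (2 ^ N - 1), phase n t • (component n φ : L2S2) : L2S2) x =
        ∑ j ∈ Finset.range N, blockFlow φ j t x :=
    ae_all_iff.2 fun N => by
      filter_upwards [sum_smul_coe_ae_eq (Finset.range (2 ^ N - 1)) (fun n => phase n t)
        fun n => component n φ] with x hx
      rw [hx, ← sum_dyadicBlock]
      rfl
  filter_upwards [hae, hrep] with x h1 h2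
  refine tendsto_nhds_unique h1 ?_
  have h3 : HasSum (fun j => blockFlow φ j t x) (∑' j, blockFlow φ j t x) :=
    (Summable.of_norm_bounded hsum fun j => norm_blockFlow_le (hfin j) t x).hasSum
  refine (h3.tendsto_sum_nat.comp hns.tendsto_atTop).congr fun i => ?_
  exact (h2 (ns i)).symm

end Components

lemma IsContinuousVersion.tendstoUniformly {φ : L2S2} {u : ℝ → S2 → ℂ}
    (hu : IsContinuousVersion φ u) : TendstoUniformly u (u 0) (𝓝 0) :=
  Continuous.tendstoUniformly u hu.1 0

lemma IsContinuousVersion.tendsto_ae {φ : L2S2} {u : ℝ → S2 → ℂ}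
    (hu : IsContinuousVersion φ u) (h0 : schrodingerFlow 0 φ = φ) :
    ∀ᵐ x ∂sphereMeasure, Tendsto (fun t : ℝ => u t x) (𝓝 0) (𝓝 (φ x)) := by
  have h := hu.2 0
  rw [h0] at h
  filter_upwards [h] with x hx
  rw [hx]
  exact hu.tendstoUniformly.tendsto_at x

lemma IsContinuousVersion.tendsto_eLpNorm {φ : L2S2} {u : ℝ → S2 → ℂ}
    (hu : IsContinuousVersion φ u) (h0 : schrodingerFlow 0 φ = φ) :
    Tendsto (fun t : ℝ => eLpNorm (fun x => schrodingerFlow t φ x - φ x) ∞ sphereMeasure)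
      (𝓝 0) (𝓝 0) := by
  have h := hu.2 0
  rw [h0] at h
  rw [ENNReal.tendsto_nhds_zero]
  intro ε hε
  obtain ⟨δ, hδ, hδε⟩ := ENNReal.lt_iff_exists_nnreal_btwn.1 hε
  have hδ' : (0 : ℝ) < δ := by exact_mod_cast hδ
  filter_upwards [Metric.tendstoUniformly_iff.1 hu.tendstoUniformly δ hδ'] with t ht
  rw [eLpNorm_exponent_top]
  refine (eLpNormEssSup_le_of_ae_bound (C := δ) ?_).trans ?_
  · filter_upwards [h, hu.2 t] with x h1 h2
    rw [h1, h2, ← dist_eq_norm, dist_comm]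
    exact (ht x).le
  · rw [ENNReal.ofReal_coe_nnreal]
    exact hδε.le

/-! ### Reduction of the supremum of a block to a finite grid -/

lemma norm_phase_sub_le (n : ℕ) (t t' : ℝ) :
    ‖phase n t - phase n t'‖ ≤ ((n : ℝ) + 1) ^ 2 * |t - t'| := by
  have e : phase n t - phase n t' =
      phase n t' * (Complex.exp (Complex.I * ((-((t - t') * (n * (n + 1))) : ℝ) : ℂ)) - 1) := by
    rw [mul_sub, mul_one]
    congr 1
    unfold phase
    rw [← Complex.exp_add]
    congr 1
    push_cast
    ring
  rw [e, norm_mul, norm_phase, one_mul]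
  refine Real.norm_exp_I_mul_ofReal_sub_one_le.trans ?_
  have hn : (0 : ℝ) ≤ n := n.cast_nonneg
  rw [norm_neg, norm_mul, Real.norm_eq_abs, Real.norm_of_nonneg (by positivity), mul_comm]
  gcongr
  nlinarith

lemma phase_sub_two_pi (n : ℕ) (t : ℝ) (m : ℤ) : phase n (t - m * (2 * Real.pi)) = phase n t := by
  unfold phase
  rw [Complex.exp_eq_exp_iff_exists_int]
  refine ⟨m * (n * (n + 1)), ?_⟩
  push_cast
  ring

lemma exists_abs_le_pi_phase_eq (t : ℝ) :
    ∃ t' : ℝ, |t'| ≤ Real.pi ∧ ∀ n, phase n t' = phase n t := by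
  refine ⟨t - round (t / (2 * Real.pi)) * (2 * Real.pi), ?_, fun n => phase_sub_two_pi n t _⟩
  have h := abs_sub_round (t / (2 * Real.pi))
  have hpi := Real.pi_pos
  have e : t - round (t / (2 * Real.pi)) * (2 * Real.pi) =
      (t / (2 * Real.pi) - round (t / (2 * Real.pi))) * (2 * Real.pi) := by
    field_simp
  rw [e, abs_mul, abs_of_pos (a := 2 * Real.pi) (by positivity)]
  nlinarith

/-- The numerators `k` of the points `k / 32 ^ j` of the interval `[-4, 4]`. The mesh is chosen to
beat the factor `16 ^ j` by which a dyadic block can vary, see `norm_blockFlow_sub_le`. -/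
def grid (j : ℕ) : Finset ℤ := Finset.Icc (-(4 * 32 ^ j)) (4 * 32 ^ j)

lemma card_grid_le (j : ℕ) : ((grid j).card : ℝ) ≤ 9 * 32 ^ j := by
  have h : (grid j).card = 8 * 32 ^ j + 1 := by
    rw [grid, Int.card_Icc]
    have : (4 * 32 ^ j + 1 - -(4 * 32 ^ j) : ℤ) = ((8 * 32 ^ j + 1 : ℕ) : ℤ) := by push_cast; ring
    rw [this, Int.toNat_natCast]
  rw [h]
  have : (1 : ℝ) ≤ 32 ^ j := one_le_pow₀ (by norm_num)
  push_cast
  linarith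

lemma exists_grid (j : ℕ) {s : ℝ} (hs : |s| ≤ Real.pi) :
    ∃ k ∈ grid j, |s - k / 32 ^ j| ≤ (32 ^ j)⁻¹ := by
  have h32 : (0 : ℝ) < 32 ^ j := by positivity
  have hpi := Real.pi_lt_four
  have h1 := abs_le.1 hs
  refine ⟨⌊s * 32 ^ j⌋, Finset.mem_Icc.2 ⟨Int.le_floor.2 ?_, ?_⟩, ?_⟩
  · push_cast
    nlinarith
  · refine Int.floor_le_iff.2 ?_
    push_cast
    nlinarith
  · have e : s - ⌊s * 32 ^ j⌋ / 32 ^ j = (s * 32 ^ j - ⌊s * 32 ^ j⌋) * (32 ^ j)⁻¹ := by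
      field_simp
    rw [e, abs_mul, abs_of_pos (inv_pos.2 h32), Int.self_sub_floor,
      abs_of_nonneg (Int.fract_nonneg _)]
    exact mul_le_of_le_one_left (by positivity) (Int.fract_lt_one _).le

lemma card_dyadicBlock (j : ℕ) : (dyadicBlock j).card = 2 ^ j := by
  rw [dyadicBlock, Nat.card_Ico, pow_succ]
  have : 0 < 2 ^ j := by positivity
  omega

lemma le_of_mem_dyadicBlock {j n : ℕ} (h : n ∈ dyadicBlock j) :
    (2 : ℝ) ^ j ≤ (n : ℝ) + 1 ∧ (n : ℝ) + 1 ≤ 2 ^ (j + 1) := by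
  have h1 := Finset.mem_Ico.1 h
  have : 2 ^ j ≤ n + 1 ∧ n + 1 ≤ 2 ^ (j + 1) := by omega
  exact_mod_cast this

section Grid

variable [∀ n, FiniteDimensional ℂ (harmonicSpace n)]

lemma norm_component_le (n : ℕ) (φ : L2S2) : ‖component n φ‖ ≤ ‖φ‖ := by
  have h := sum_norm_sq_component_le φ {n}
  rw [Finset.sum_singleton] at h
  exact le_of_sq_le_sq h (norm_nonneg _)

lemma norm_blockFlow_sub_le (hn : ∀ n, Module.finrank ℂ (harmonicSpace n) = 2 * n + 1)
    (φ : L2S2) (j : ℕ) {h : ℝ} {t t' θ θ' η η' : ℝ} (ht : |t - t'| ≤ h) (hθ : |θ - θ'| ≤ h)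
    (hη : |η - η'| ≤ h) :
    ‖blockFlow φ j t (spherePoint θ η) - blockFlow φ j t' (spherePoint θ' η')‖ ≤
      24 * 16 ^ j * h * ‖φ‖ := by
  have h0 : 0 ≤ h := (abs_nonneg _).trans ht
  unfold blockFlow
  rw [← Finset.sum_sub_distrib]
  have hterm : ∀ n ∈ dyadicBlock j, ‖phase n t * rep n (component n φ) (spherePoint θ η) -
      phase n t' * rep n (component n φ) (spherePoint θ' η')‖ ≤ 24 * 8 ^ j * h * ‖φ‖ := by
    intro n hnj
    have hN := (le_of_mem_dyadicBlock hnj).2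
    have hn0 : (0 : ℝ) ≤ n := n.cast_nonneg
    have e : phase n t * rep n (component n φ) (spherePoint θ η) -
      phase n t' * rep n (component n φ) (spherePoint θ' η') =
      (phase n t - phase n t') * rep n (component n φ) (spherePoint θ η) +
      phase n t' * (rep n (component n φ) (spherePoint θ η) -
        rep n (component n φ) (spherePoint θ' η')) := by ring
    have h1 := norm_phase_sub_le n t t'
    have h2 := norm_rep_le (hn n) (component n φ) (spherePoint θ η)
    have h3 := norm_rep_spherePoint_sub_le (hn n) (component n φ) θ θ' η η'
    have h4 := norm_component_le n φ
    rw [e]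
    calc _ ≤ ‖phase n t - phase n t'‖ * ‖rep n (component n φ) (spherePoint θ η)‖ +
          1 * ‖rep n (component n φ) (spherePoint θ η) -
            rep n (component n φ) (spherePoint θ' η')‖ := by
          refine (norm_add_le _ _).trans ?_
          rw [norm_mul, norm_mul, norm_phase]
      _ ≤ (((n : ℝ) + 1) ^ 2 * h) * (((n : ℝ) + 1) * ‖φ‖) +
          1 * (((n : ℝ) + 1) ^ 2 * (h + h) * ‖φ‖) := by
          gcongr
          · exact h1.trans (by gcongr)
          · exact h2.trans (by gcongr)
          · exact h3.trans (by gcongr)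
      _ ≤ (((n : ℝ) + 1) ^ 2 * h) * (((n : ℝ) + 1) * ‖φ‖) +
          ((n : ℝ) + 1) * (((n : ℝ) + 1) ^ 2 * (h + h) * ‖φ‖) := by
          gcongr
          linarith
      _ = 3 * ((n : ℝ) + 1) ^ 3 * h * ‖φ‖ := by ring
      _ ≤ 3 * (2 ^ (j + 1)) ^ 3 * h * ‖φ‖ := by gcongr
      _ = 24 * 8 ^ j * h * ‖φ‖ := by
          have h8 : (8 : ℝ) ^ j = (2 ^ j) ^ 3 := by
            rw [← pow_mul, mul_comm, pow_mul]
            norm_num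
          rw [h8]
          ring
  refine (norm_sum_le_of_le _ hterm).trans (le_of_eq ?_)
  rw [Finset.sum_const, card_dyadicBlock, nsmul_eq_mul, show (16 : ℝ) = 2 * 8 by norm_num, mul_pow]
  push_cast
  ring

/-- The supremum of a dyadic block is controlled by its values on a grid of polynomial size. -/
lemma blockSup_le_of_grid (hn : ∀ n, Module.finrank ℂ (harmonicSpace n) = 2 * n + 1)
    (φ : L2S2) (j : ℕ) {M : ℝ}
    (hM : ∀ k ∈ grid j, ∀ l ∈ grid j, ∀ m ∈ grid j,
      ‖blockFlow φ j ((k : ℝ) / 32 ^ j) (spherePoint ((l : ℝ) / 32 ^ j) ((m : ℝ) / 32 ^ j))‖ ≤ M) :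
    blockSup φ j ≤ ENNReal.ofReal (M + 24 * ‖φ‖ * (1 / 2) ^ j) := by
  refine iSup_le fun p => ?_
  obtain ⟨t, ht, hphase⟩ := exists_abs_le_pi_phase_eq p.1
  obtain ⟨θ, η, hθ, hη, hp⟩ := exists_spherePoint_eq p.2
  have e : blockFlow φ j p.1 p.2 = blockFlow φ j t (spherePoint θ η) := by
    simp only [blockFlow, hphase, hp]
  obtain ⟨k, hk, hk'⟩ := exists_grid j ht
  obtain ⟨l, hl, hl'⟩ := exists_grid j hθ
  obtain ⟨m, hm, hm'⟩ := exists_grid j hη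
  rw [e, ← ofReal_norm]
  refine ENNReal.ofReal_le_ofReal ?_
  have h1 := norm_blockFlow_sub_le hn φ j hk' hl' hm'
  have h2 := hM k hk l hl m hm
  have h3 : 24 * 16 ^ j * ((32 : ℝ) ^ j)⁻¹ * ‖φ‖ = 24 * ‖φ‖ * (1 / 2) ^ j := by
    rw [show (32 : ℝ) = 16 * 2 by norm_num, mul_pow, one_div, inv_pow]
    field_simp
  rw [h3] at h1
  have h4 := norm_le_norm_add_norm_sub'
    (blockFlow φ j t (spherePoint θ η))
    (blockFlow φ j ((k : ℝ) / 32 ^ j) (spherePoint ((l : ℝ) / 32 ^ j) ((m : ℝ) / 32 ^ j)))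
  linarith

lemma blockSup_ne_top (hn : ∀ n, Module.finrank ℂ (harmonicSpace n) = 2 * n + 1)
    (φ : L2S2) (j : ℕ) : blockSup φ j ≠ ∞ := by
  refine ne_top_of_le_ne_top ENNReal.ofReal_ne_top (blockSup_le_of_grid hn φ j
    (M := ∑ n ∈ dyadicBlock j, ((n : ℝ) + 1) * ‖component n φ‖) fun k _ l _ m _ => ?_)
  refine norm_sum_le_of_le _ fun n _ => ?_
  rw [norm_mul, norm_phase, one_mul]
  exact norm_rep_le (hn n) _ _

end Grid

/-! ### Sub-Gaussian bounds for complex Gaussian sums -/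

open scoped NNReal

lemma hasSubgaussianMGF_gaussianReal (v : ℝ≥0) :
    HasSubgaussianMGF (fun x => x) v (gaussianReal 0 v) where
  integrable_exp_mul t := integrable_exp_mul_gaussianReal t
  mgf_le t := by simp [mgf_fun_id_gaussianReal]

lemma hasSubgaussianMGF_re_mul (c : ℂ) :
    HasSubgaussianMGF (fun z : ℂ => (c * z).re) (‖c‖₊ ^ 2 / 2) stdComplexGaussian := by
  unfold stdComplexGaussian
  have hm : Measurable fun p : ℝ × ℝ => (p.1 : ℂ) + (p.2 : ℂ) * Complex.I := by fun_prop
  rw [← HasSubgaussianMGF.id_map_iff (by fun_prop), Measure.map_map (by fun_prop) hm,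
    HasSubgaussianMGF.id_map_iff (by fun_prop)]
  have h1 : HasSubgaussianMGF (fun p : ℝ × ℝ => p.1) (1 / 2)
      ((gaussianReal 0 (1 / 2)).prod (gaussianReal 0 (1 / 2))) :=
    HasSubgaussianMGF.of_map (X := fun x => x) measurable_fst.aemeasurable
      (by rw [measurePreserving_fst.map_eq]; exact hasSubgaussianMGF_gaussianReal _)
  have h2 : HasSubgaussianMGF (fun p : ℝ × ℝ => p.2) (1 / 2)
      ((gaussianReal 0 (1 / 2)).prod (gaussianReal 0 (1 / 2))) :=
    HasSubgaussianMGF.of_map (X := fun x => x) measurable_snd.aemeasurable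
      (by rw [measurePreserving_snd.map_eq]; exact hasSubgaussianMGF_gaussianReal _)
  have h3 := (h1.const_mul c.re).add_of_indepFun (h2.const_mul (-c.im))
    (indepFun_prod (X := fun x : ℝ => c.re * x) (Y := fun x : ℝ => -c.im * x)
      (by fun_prop) (by fun_prop))
  convert h3 using 1
  · funext p
    simp
    ring
  · ext
    have h := Complex.sq_norm c
    rw [Complex.normSq_apply] at h
    push_cast
    rw [h]
    change _ = c.re ^ 2 * (1 / 2) + (-c.im) ^ 2 * (1 / 2)
    ring

lemma lintegral_enorm_sq_stdComplexGaussian :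
    ∫⁻ z, ‖z‖ₑ ^ 2 ∂stdComplexGaussian ≠ ∞ := by
  have h1 := (hasSubgaussianMGF_re_mul 1).memLp 2
  have h2 := (hasSubgaussianMGF_re_mul (-Complex.I)).memLp 2
  have h : MemLp (fun z : ℂ => z) 2 stdComplexGaussian := by
    refine memLp_re_im_iff.1 ⟨?_, ?_⟩
    · simpa using h1
    · simpa using h2
  have h3 := lintegral_rpow_enorm_lt_top_of_eLpNorm_lt_top (by norm_num) (by norm_num)
    h.eLpNorm_lt_top
  simpa using h3.ne

section Tail

variable {Ω ι : Type*} [MeasurableSpace Ω] {P : Measure Ω} {g : ι → Ω → ℂ}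

lemma measureReal_re_sum_ge_le [IsProbabilityMeasure P]
    (hlaw : ∀ i, HasLaw (g i) stdComplexGaussian P) (hind : iIndepFun g P) (s : Finset ι)
    (c : ι → ℂ) {V a : ℝ} (hV : ∑ i ∈ s, ‖c i‖ ^ 2 ≤ V) (ha : 0 ≤ a) :
    P.real {ω | a ≤ (∑ i ∈ s, c i * g i ω).re} ≤ Real.exp (-a ^ 2 / V) := by
  have h1 : ∀ i ∈ s, HasSubgaussianMGF (fun ω => (c i * g i ω).re) (‖c i‖₊ ^ 2 / 2) P :=
    fun i _ => HasSubgaussianMGF.of_map (X := fun z : ℂ => (c i * z).re) (hlaw i).aemeasurable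
      (by rw [(hlaw i).map_eq]; exact hasSubgaussianMGF_re_mul (c i))
  have h2 : iIndepFun (fun i ω => (c i * g i ω).re) P :=
    hind.comp (fun i z => (c i * z).re) fun i => by fun_prop
  have h3 := HasSubgaussianMGF.sum_of_iIndepFun h2 h1
  have hV0 : 0 ≤ V := (Finset.sum_nonneg fun i _ => sq_nonneg _).trans hV
  -- weakening the variance before the Chernoff bound avoids a division by zero when all `c i` vanish
  have h4 : HasSubgaussianMGF (fun ω => ∑ i ∈ s, (c i * g i ω).re) ⟨V / 2, by positivity⟩ P := by
    refine ⟨h3.integrable_exp_mul, fun t => (h3.mgf_le t).trans ?_⟩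
    have h5 : ((∑ i ∈ s, ‖c i‖₊ ^ 2 / 2 : ℝ≥0) : ℝ) ≤ V / 2 := by
      push_cast
      rw [← Finset.sum_div]
      linarith
    change _ ≤ Real.exp (V / 2 * t ^ 2 / 2)
    gcongr
  have h5 := h4.measure_ge_le ha
  simp only [Complex.re_sum]
  refine h5.trans (le_of_eq ?_)
  congr 2
  change 2 * (V / 2) = V
  ring

lemma measureReal_norm_sum_ge_le [IsProbabilityMeasure P]
    (hlaw : ∀ i, HasLaw (g i) stdComplexGaussian P) (hind : iIndepFun g P) (s : Finset ι)
    (c : ι → ℂ) {V a : ℝ} (hV : ∑ i ∈ s, ‖c i‖ ^ 2 ≤ V) (ha : 0 ≤ a) :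
    P.real {ω | 2 * a ≤ ‖∑ i ∈ s, c i * g i ω‖} ≤ 4 * Real.exp (-a ^ 2 / V) := by
  have key : ∀ u : ℂ, ‖u‖ = 1 →
      P.real {ω | a ≤ (u * ∑ i ∈ s, c i * g i ω).re} ≤ Real.exp (-a ^ 2 / V) := by
    intro u hu
    have h := measureReal_re_sum_ge_le hlaw hind s (fun i => u * c i) (V := V)
      (by simpa [hu] using hV) ha
    simpa only [Finset.mul_sum, mul_assoc] using h
  -- a complex number of modulus at least `2 a` has a real or imaginary part of modulus at least `a`
  have hsub : {ω | 2 * a ≤ ‖∑ i ∈ s, c i * g i ω‖} ⊆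
      ({ω | a ≤ (1 * ∑ i ∈ s, c i * g i ω).re} ∪ {ω | a ≤ (-1 * ∑ i ∈ s, c i * g i ω).re}) ∪
      ({ω | a ≤ (Complex.I * ∑ i ∈ s, c i * g i ω).re} ∪
        {ω | a ≤ (-Complex.I * ∑ i ∈ s, c i * g i ω).re}) := by
    intro ω hω
    have h1 := Complex.norm_le_abs_re_add_abs_im (∑ i ∈ s, c i * g i ω)
    have h2 : 2 * a ≤ ‖∑ i ∈ s, c i * g i ω‖ := hω
    simp only [Set.mem_union, Set.mem_ofPred_eq, one_mul, neg_mul, Complex.neg_re,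
      Complex.I_mul_re, neg_neg]
    by_contra! hcon
    obtain ⟨⟨h3, h4⟩, h5, h6⟩ := hcon
    have h7 : |(∑ i ∈ s, c i * g i ω).re| < a := abs_lt.2 ⟨by linarith, h3⟩
    have h8 : |(∑ i ∈ s, c i * g i ω).im| < a := abs_lt.2 ⟨by linarith, h6⟩
    linarith
  refine (measureReal_mono hsub).trans ?_
  refine (measureReal_union_le _ _).trans ?_
  have h1 := measureReal_union_le (μ := P) {ω | a ≤ (1 * ∑ i ∈ s, c i * g i ω).re}
    {ω | a ≤ (-1 * ∑ i ∈ s, c i * g i ω).re}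
  have h2 := measureReal_union_le (μ := P) {ω | a ≤ (Complex.I * ∑ i ∈ s, c i * g i ω).re}
    {ω | a ≤ (-Complex.I * ∑ i ∈ s, c i * g i ω).re}
  have k1 := key 1 (by simp)
  have k2 := key (-1) (by simp)
  have k3 := key Complex.I (by simp)
  have k4 := key (-Complex.I) (by simp)
  linarith

end Tail

/-- Stretched exponentials beat geometric growth: the exponent is `-(p⁻²) ^ j / K`. -/
lemma summable_pow_mul_exp {A p K : ℝ} (hA : 0 < A) (hp0 : 0 < p) (hp1 : p < 1) (hK : 0 < K) :
    Summable fun j : ℕ => A ^ j * Real.exp (-(p ^ j) ^ 2 / (K * (p ^ j) ^ 4)) := by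
  obtain ⟨m, hm⟩ := exists_pow_lt_of_lt_one (show 0 < (2 * A)⁻¹ by positivity)
    (show p ^ 2 < 1 by nlinarith)
  have hbound : ∀ j : ℕ, A ^ j * Real.exp (-(p ^ j) ^ 2 / (K * (p ^ j) ^ 4)) ≤
      (m.factorial * K ^ m) * (1 / 2) ^ j := by
    intro j
    set y := (K * (p ^ j) ^ 2)⁻¹ with hy
    have hy0 : 0 < y := by positivity
    have e : -(p ^ j) ^ 2 / (K * (p ^ j) ^ 4) = -y := by
      rw [hy]; field_simp
    have h1 := Real.pow_div_factorial_le_exp y hy0.le m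
    have h2 : Real.exp (-y) ≤ m.factorial * (K * (p ^ j) ^ 2) ^ m := by
      rw [Real.exp_neg, inv_le_comm₀ (Real.exp_pos _) (by positivity)]
      refine le_trans (le_of_eq ?_) h1
      rw [hy, inv_pow, mul_inv]
      field_simp
    have h3 : A * (p ^ 2) ^ m ≤ 1 / 2 := by
      have := mul_le_mul_of_nonneg_left hm.le hA.le
      refine this.trans (le_of_eq ?_)
      field_simp
    rw [e]
    calc A ^ j * Real.exp (-y) ≤ A ^ j * (m.factorial * (K * (p ^ j) ^ 2) ^ m) := by gcongr
      _ = (m.factorial * K ^ m) * (A * (p ^ 2) ^ m) ^ j := by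
          rw [mul_pow, mul_pow, ← pow_mul, ← pow_mul, ← pow_mul, ← pow_mul]
          ring
      _ ≤ _ := by gcongr
  exact Summable.of_nonneg_of_le (fun j => by positivity) hbound
    ((summable_geometric_of_lt_one (by norm_num) (by norm_num)).mul_left _)

/-! ### The random data -/

lemma eigenfrequency_pos (n : ℕ) : 0 < eigenfrequency n := Real.sqrt_pos.2 (by positivity)

lemma half_le_eigenfrequency (n : ℕ) : ((n : ℝ) + 1) / 2 ≤ eigenfrequency n := by
  refine Real.le_sqrt_of_sq_le ?_
  nlinarith [n.cast_nonneg (α := ℝ)]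

/-- The variance of the degree-`n` part at a point decays like `n ^ (1 - 2 α)`. -/
lemma eigenfrequency_rpow_sq_mul_le {α : ℝ} (hα : 0 ≤ α) (n : ℕ) :
    (eigenfrequency n ^ (-α)) ^ 2 * (2 * n + 1) ≤
      2 * 2 ^ (2 * α) * ((n : ℝ) + 1) ^ (1 - 2 * α) := by
  have hn : (0 : ℝ) ≤ n := n.cast_nonneg
  have hx : (0 : ℝ) < n + 1 := by positivity
  have h1 : eigenfrequency n ^ (-α) ≤ (((n : ℝ) + 1) / 2) ^ (-α) :=
    Real.rpow_le_rpow_of_nonpos (by positivity) (half_le_eigenfrequency n) (by linarith)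
  have h0 : 0 ≤ eigenfrequency n ^ (-α) := Real.rpow_nonneg (eigenfrequency_pos n).le _
  calc (eigenfrequency n ^ (-α)) ^ 2 * (2 * n + 1)
      ≤ ((((n : ℝ) + 1) / 2) ^ (-α)) ^ 2 * (2 * (n + 1)) := by gcongr; linarith
    _ = 2 * 2 ^ (2 * α) * ((n : ℝ) + 1) ^ (1 - 2 * α) := by
        rw [← Real.rpow_natCast, ← Real.rpow_mul (by positivity),
          Real.div_rpow hx.le (by norm_num), sub_eq_add_neg, Real.rpow_add hx, Real.rpow_one]
        have e1 : -α * ((2 : ℕ) : ℝ) = -(2 * α) := by push_cast; ring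
        rw [e1, Real.rpow_neg (by norm_num : (0 : ℝ) ≤ 2)]
        have : (2 : ℝ) ^ (2 * α) ≠ 0 := by positivity
        field_simp

lemma summable_eigenfrequency {α : ℝ} (hα : 1 < α) :
    Summable fun n : ℕ => (eigenfrequency n ^ (-α)) ^ 2 * (2 * n + 1) := by
  have h : Summable fun n : ℕ => 2 * 2 ^ (2 * α) * ((n : ℝ) + 1) ^ (1 - 2 * α) := by
    refine Summable.mul_left _ ?_
    refine ((Real.summable_one_div_nat_add_rpow 1 (2 * α - 1)).2 (by linarith)).congr fun n => ?_
    have hx : (0 : ℝ) < n + 1 := by positivity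
    rw [abs_of_pos hx, one_div, ← Real.rpow_neg hx.le, neg_sub]
  exact Summable.of_nonneg_of_le (fun n => by positivity)
    (eigenfrequency_rpow_sq_mul_le (by linarith)) h

lemma sum_dyadicBlock_eigenfrequency_le {α : ℝ} (hα : 1 < α) (j : ℕ) :
    ∑ n ∈ dyadicBlock j, (eigenfrequency n ^ (-α)) ^ 2 * (2 * n + 1) ≤
      2 * 2 ^ (2 * α) * (((2 : ℝ) ^ ((1 - α) / 2)) ^ j) ^ 4 := by
  have h2 : (0 : ℝ) < 2 ^ j := by positivity
  have hterm : ∀ n ∈ dyadicBlock j, (eigenfrequency n ^ (-α)) ^ 2 * (2 * n + 1) ≤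
      2 * 2 ^ (2 * α) * ((2 : ℝ) ^ j) ^ (1 - 2 * α) := fun n hn =>
    (eigenfrequency_rpow_sq_mul_le (by linarith) n).trans (mul_le_mul_of_nonneg_left
      (Real.rpow_le_rpow_of_nonpos h2 (le_of_mem_dyadicBlock hn).1 (by linarith)) (by positivity))
  refine (Finset.sum_le_sum hterm).trans (le_of_eq ?_)
  rw [Finset.sum_const, card_dyadicBlock, nsmul_eq_mul, ← pow_mul, ← Real.rpow_natCast _ (j * 4),
    ← Real.rpow_mul (by norm_num), Nat.cast_pow, Nat.cast_ofNat, mul_left_comm]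
  congr 1
  calc (2 : ℝ) ^ j * ((2 : ℝ) ^ j) ^ (1 - 2 * α) = ((2 : ℝ) ^ j) ^ (1 + (1 - 2 * α)) := by
        rw [Real.rpow_add h2, Real.rpow_one]
    _ = _ := by
        rw [← Real.rpow_natCast, ← Real.rpow_mul (by norm_num)]
        congr 1
        push_cast
        ring

lemma component_eq_of_hasSum [∀ n, FiniteDimensional ℂ (harmonicSpace n)]
    {f : ∀ n, harmonicSpace n} {φ : L2S2} (h : HasSum (fun n => (f n : L2S2)) φ) (n : ℕ) :
    component n φ = f n := by
  refine Subtype.ext (spectralProjection_eq (f n) fun χ => ?_)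
  have h1 := (innerSL ℂ (χ : L2S2)).hasSum h
  have h2 : HasSum (fun m => innerSL ℂ (χ : L2S2) (f m : L2S2)) (inner ℂ (χ : L2S2) (f n : L2S2)) :=
    hasSum_single n fun m hm => harmonicSpace_orthogonal hm.symm χ (f m)
  have h3 : inner ℂ (χ : L2S2) φ = inner ℂ (χ : L2S2) (f n : L2S2) := h1.unique h2
  rw [inner_eq_zero_symm, inner_sub_right, h3, sub_self]

/-- The degree-`n` part of the randomized data as a spherical harmonic. -/
def randomHarmonic (α : ℝ) (b : ∀ n : ℕ, OrthonormalBasis (Order n) ℂ (harmonicSpace n))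
    (g : ∀ n : ℕ, Order n → ℂ) (n : ℕ) : harmonicSpace n :=
  ((eigenfrequency n ^ (-α) : ℝ) : ℂ) • ∑ k : Order n, g n k • b n k

lemma coe_randomHarmonic (α : ℝ) (b : ∀ n : ℕ, OrthonormalBasis (Order n) ℂ (harmonicSpace n))
    (g : ∀ n : ℕ, Order n → ℂ) (n : ℕ) :
    (randomHarmonic α b g n : L2S2) = randomPart α b g n := by
  simp only [randomHarmonic, randomPart, Submodule.coe_smul, Submodule.coe_sum]

lemma card_order (n : ℕ) : Fintype.card (Order n) = 2 * n + 1 := by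
  rw [Fintype.card_coe, Int.card_Icc]
  omega

lemma norm_sq_randomHarmonic (α : ℝ)
    (b : ∀ n : ℕ, OrthonormalBasis (Order n) ℂ (harmonicSpace n))
    (g : ∀ n : ℕ, Order n → ℂ) (n : ℕ) :
    ‖randomHarmonic α b g n‖ ^ 2 =
      (eigenfrequency n ^ (-α)) ^ 2 * ∑ k, ‖g n k‖ ^ 2 := by
  have h0 : 0 ≤ eigenfrequency n ^ (-α) := Real.rpow_nonneg (eigenfrequency_pos n).le _
  have h1 := (b n).sum_sq_norm_inner_right (∑ k : Order n, g n k • b n k)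
  have h2 : ∀ i, ‖inner ℂ (b n i) (∑ k : Order n, g n k • b n k)‖ ^ 2 = ‖g n i‖ ^ 2 := fun i => by
    rw [(b n).orthonormal.inner_right_fintype]
  simp only [h2] at h1
  rw [randomHarmonic, norm_smul, mul_pow, ← h1, Complex.norm_real, Real.norm_of_nonneg h0]

lemma rep_randomHarmonic (α : ℝ)
    (b : ∀ n : ℕ, OrthonormalBasis (Order n) ℂ (harmonicSpace n))
    (g : ∀ n : ℕ, Order n → ℂ) (n : ℕ) (x : S2) :
    rep n (randomHarmonic α b g n) x =
      ((eigenfrequency n ^ (-α) : ℝ) : ℂ) * ∑ k, g n k * rep n (b n k) x := by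
  simp [randomHarmonic]

section RandomData

variable {Ω : Type*} [MeasurableSpace Ω] {P : Measure Ω} {α : ℝ}
  (b : ∀ n : ℕ, OrthonormalBasis (Order n) ℂ (harmonicSpace n))
  {g : ∀ n : ℕ, Order n → Ω → ℂ}

lemma ae_summable_norm_sq_randomHarmonic (hα : 1 < α)
    (hg_law : ∀ (n : ℕ) (k : Order n), HasLaw (g n k) stdComplexGaussian P) :
    ∀ᵐ ω ∂P, Summable fun n => ‖randomHarmonic α b (fun n k => g n k ω) n‖ ^ 2 := by
  set w : ℕ → ℝ := fun n => (eigenfrequency n ^ (-α)) ^ 2 with hw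
  have hmeas : ∀ n k, AEMeasurable (fun ω => ‖g n k ω‖ₑ ^ 2) P := fun n k =>
    (hg_law n k).aemeasurable.enorm.pow_const 2
  have hmeas' : ∀ n, AEMeasurable (fun ω => ENNReal.ofReal (w n) * ∑ k, ‖g n k ω‖ₑ ^ 2) P :=
    fun n => (Finset.aemeasurable_fun_sum _ fun k _ => hmeas n k).const_mul _
  have hint : ∫⁻ ω, ∑' n, ENNReal.ofReal (w n) * ∑ k, ‖g n k ω‖ₑ ^ 2 ∂P ≠ ∞ := by
    have hE : ∀ n k, ∫⁻ ω, ‖g n k ω‖ₑ ^ 2 ∂P = ∫⁻ z, ‖z‖ₑ ^ 2 ∂stdComplexGaussian := fun n k =>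
      (hg_law n k).lintegral_comp (f := fun z : ℂ => ‖z‖ₑ ^ 2) (by fun_prop)
    have hterm : ∀ n, ∫⁻ ω, ENNReal.ofReal (w n) * ∑ k, ‖g n k ω‖ₑ ^ 2 ∂P =
        ENNReal.ofReal (w n * (2 * n + 1)) * ∫⁻ z, ‖z‖ₑ ^ 2 ∂stdComplexGaussian := fun n => by
      rw [lintegral_const_mul'' _ (Finset.aemeasurable_fun_sum _ fun k _ => hmeas n k),
        lintegral_finsetSum' _ fun k _ => hmeas n k]
      simp only [hE, Finset.sum_const, Finset.card_univ, card_order, nsmul_eq_mul]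
      rw [ENNReal.ofReal_mul (sq_nonneg _), mul_assoc]
      congr 2
      rw [← ENNReal.ofReal_natCast]
      push_cast
      rfl
    rw [lintegral_tsum hmeas', tsum_congr hterm, ENNReal.tsum_mul_right]
    exact ENNReal.mul_ne_top (summable_eigenfrequency hα).tsum_ofReal_ne_top
      lintegral_enorm_sq_stdComplexGaussian
  have hae := ae_lt_top' (AEMeasurable.tsum hmeas') hint
  filter_upwards [hae] with ω hω
  refine (ENNReal.summable_toReal hω.ne).congr fun n => ?_
  rw [norm_sq_randomHarmonic, ENNReal.toReal_mul, ENNReal.toReal_ofReal (sq_nonneg _),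
    ENNReal.toReal_sum fun k _ => ENNReal.pow_ne_top enorm_ne_top]
  simp

lemma ae_summable_randomPart (hα : 1 < α)
    (hg_law : ∀ (n : ℕ) (k : Order n), HasLaw (g n k) stdComplexGaussian P) :
    ∀ᵐ ω ∂P, Summable (randomPart α b (fun n k => g n k ω)) := by
  have : ∀ n, FiniteDimensional ℂ (harmonicSpace n) := fun n =>
    Module.Finite.of_basis (b n).toBasis
  filter_upwards [ae_summable_norm_sq_randomHarmonic b hα hg_law] with ω hω
  have h : Summable fun n => (randomHarmonic α b (fun n k => g n k ω) n : L2S2) :=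
    (orthogonalFamily_harmonicSpace.summable_iff_norm_sq_summable
      (fun n => randomHarmonic α b (fun n k => g n k ω) n)).2 hω
  simpa only [coe_randomHarmonic] using h

lemma aemeasurable_randomData (hα : 1 < α)
    (hg_law : ∀ (n : ℕ) (k : Order n), HasLaw (g n k) stdComplexGaussian P) :
    AEMeasurable (fun ω => randomData α b (fun n k => g n k ω)) P := by
  refine AEStronglyMeasurable.aemeasurable ?_
  refine aestronglyMeasurable_of_tendsto_ae atTop
    (f := fun N ω => ∑ n ∈ Finset.range N, randomPart α b (fun n k => g n k ω) n) (fun N => ?_) ?_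
  · refine Finset.aestronglyMeasurable_fun_sum _ fun n _ => ?_
    refine AEStronglyMeasurable.const_smul (Finset.aestronglyMeasurable_fun_sum _ fun k _ => ?_)
      ((eigenfrequency n ^ (-α) : ℝ) : ℂ)
    exact (hg_law n k).aemeasurable.aestronglyMeasurable.smul_const (b n k : L2S2)
  · filter_upwards [ae_summable_randomPart b hα hg_law] with ω hω
    exact hω.hasSum.tendsto_sum_nat

/-- At each point of space-time a dyadic block of the random flow is a Gaussian sum whose variance
is bounded by the addition theorem. -/
lemma measureReal_norm_block_ge_le [IsProbabilityMeasure P] (hα : 1 < α)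
    (hg_law : ∀ (n : ℕ) (k : Order n), HasLaw (g n k) stdComplexGaussian P)
    (hg_indep : iIndepFun (fun p : (Σ n : ℕ, Order n) => g p.1 p.2) P)
    (j : ℕ) (t : ℝ) (x : S2) {a : ℝ} (ha : 0 ≤ a) :
    P.real {ω | 2 * a ≤ ‖∑ n ∈ dyadicBlock j,
        phase n t * rep n (randomHarmonic α b (fun n k => g n k ω) n) x‖} ≤
      4 * Real.exp (-a ^ 2 / (2 * 2 ^ (2 * α) * (((2 : ℝ) ^ ((1 - α) / 2)) ^ j) ^ 4)) := by
  let s : Finset (Σ n : ℕ, Order n) := (dyadicBlock j).sigma fun _ => Finset.univ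
  let c : (Σ n : ℕ, Order n) → ℂ := fun p =>
    phase p.1 t * ((eigenfrequency p.1 ^ (-α) : ℝ) : ℂ) * rep p.1 (b p.1 p.2) x
  have hV : ∑ p ∈ s, ‖c p‖ ^ 2 ≤ 2 * 2 ^ (2 * α) * (((2 : ℝ) ^ ((1 - α) / 2)) ^ j) ^ 4 := by
    refine le_trans (le_of_eq ?_) (sum_dyadicBlock_eigenfrequency_le hα j)
    rw [Finset.sum_sigma]
    refine Finset.sum_congr rfl fun n _ => ?_
    have h1 := sum_norm_sq_rep (b n) x
    rw [card_order] at h1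
    have h0 : 0 ≤ eigenfrequency n ^ (-α) := Real.rpow_nonneg (eigenfrequency_pos n).le _
    simp only [c, norm_mul, norm_phase, one_mul, mul_pow, Complex.norm_real,
      Real.norm_of_nonneg h0]
    rw [← Finset.mul_sum, h1]
    push_cast
    rfl
  have h := measureReal_norm_sum_ge_le (g := fun p : (Σ n : ℕ, Order n) => g p.1 p.2)
    (fun p => hg_law p.1 p.2) hg_indep s c hV ha
  convert h using 5 with ω
  rw [Finset.sum_sigma]
  refine congrArg _ (Finset.sum_congr rfl fun n _ => ?_)
  rw [rep_randomHarmonic, ← mul_assoc, Finset.mul_sum]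
  refine Finset.sum_congr rfl fun k _ => ?_
  simp only [c]
  ring

/-- Almost surely all but finitely many dyadic blocks are small at all points of the grid. -/
lemma ae_eventually_norm_block_lt [IsProbabilityMeasure P] (hα : 1 < α)
    (hg_law : ∀ (n : ℕ) (k : Order n), HasLaw (g n k) stdComplexGaussian P)
    (hg_indep : iIndepFun (fun p : (Σ n : ℕ, Order n) => g p.1 p.2) P) :
    ∀ᵐ ω ∂P, ∀ᶠ j in atTop, ∀ k ∈ grid j, ∀ l ∈ grid j, ∀ m ∈ grid j,
      ‖∑ n ∈ dyadicBlock j, phase n ((k : ℝ) / 32 ^ j) *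
        rep n (randomHarmonic α b (fun n k => g n k ω) n)
          (spherePoint ((l : ℝ) / 32 ^ j) ((m : ℝ) / 32 ^ j))‖ <
        2 * ((2 : ℝ) ^ ((1 - α) / 2)) ^ j := by
  set p : ℝ := (2 : ℝ) ^ ((1 - α) / 2) with hp
  have hp0 : 0 < p := by positivity
  have hp1 : p < 1 := Real.rpow_lt_one_of_one_lt_of_neg (by norm_num) (by linarith)
  set K : ℝ := 2 * 2 ^ (2 * α) with hK
  have hK0 : 0 < K := by positivity
  let F : ℕ → ℤ × ℤ × ℤ → Ω → ℂ := fun j q ω =>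
    ∑ n ∈ dyadicBlock j, phase n ((q.1 : ℝ) / 32 ^ j) *
      rep n (randomHarmonic α b (fun n k => g n k ω) n)
        (spherePoint ((q.2.1 : ℝ) / 32 ^ j) ((q.2.2 : ℝ) / 32 ^ j))
  let B : ℕ → Set Ω := fun j =>
    ⋃ q ∈ grid j ×ˢ grid j ×ˢ grid j, {ω | 2 * p ^ j ≤ ‖F j q ω‖}
  have hB : ∀ j, P.real (B j) ≤
      2916 * ((32768 : ℝ) ^ j * Real.exp (-(p ^ j) ^ 2 / (K * (p ^ j) ^ 4))) := by
    intro j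
    calc P.real (B j)
        ≤ ∑ q ∈ grid j ×ˢ grid j ×ˢ grid j, P.real {ω | 2 * p ^ j ≤ ‖F j q ω‖} :=
          measureReal_biUnion_finset_le _ _
      _ ≤ ∑ q ∈ grid j ×ˢ grid j ×ˢ grid j,
            4 * Real.exp (-(p ^ j) ^ 2 / (K * (p ^ j) ^ 4)) :=
          Finset.sum_le_sum fun q _ =>
            measureReal_norm_block_ge_le b hα hg_law hg_indep j _ _ (by positivity)
      _ = ((grid j).card : ℝ) ^ 3 * (4 * Real.exp (-(p ^ j) ^ 2 / (K * (p ^ j) ^ 4))) := by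
          rw [Finset.sum_const, Finset.card_product, Finset.card_product, nsmul_eq_mul]
          push_cast
          ring
      _ ≤ (9 * 32 ^ j) ^ 3 * (4 * Real.exp (-(p ^ j) ^ 2 / (K * (p ^ j) ^ 4))) := by
          gcongr
          exact card_grid_le j
      _ = _ := by
          have h : (32768 : ℝ) ^ j = (32 ^ j) ^ 3 := by
            rw [← pow_mul, mul_comm, pow_mul]
            norm_num
          rw [h]
          ring
  have hsum : Summable fun j => P.real (B j) :=
    Summable.of_nonneg_of_le (fun _ => measureReal_nonneg) hB
      ((summable_pow_mul_exp (by norm_num) hp0 hp1 hK0).mul_left _)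
  have htsum : ∑' j, P (B j) ≠ ∞ := by
    rw [← tsum_congr fun j => ofReal_measureReal (measure_ne_top P (B j))]
    exact hsum.tsum_ofReal_ne_top
  filter_upwards [ae_eventually_notMem htsum] with ω hω
  filter_upwards [hω] with j hj k hk l hl m hm
  by_contra! hcon
  refine hj (Set.mem_biUnion (x := (k, l, m)) ?_ hcon)
  simp [hk, hl, hm]

/-- The random data almost surely lies in the set of data with a continuous flow. -/
lemma ae_randomData_mem_goodSet [∀ n, FiniteDimensional ℂ (harmonicSpace n)]
    [IsProbabilityMeasure P] (hα : 1 < α)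
    (hg_law : ∀ (n : ℕ) (k : Order n), HasLaw (g n k) stdComplexGaussian P)
    (hg_indep : iIndepFun (fun p : (Σ n : ℕ, Order n) => g p.1 p.2) P) :
    ∀ᵐ ω ∂P, randomData α b (fun n k => g n k ω) ∈ goodSet := by
  have hn : ∀ n, Module.finrank ℂ (harmonicSpace n) = 2 * n + 1 := fun n => by
    rw [Module.finrank_eq_card_basis (b n).toBasis, card_order]
  filter_upwards [ae_summable_randomPart b hα hg_law,
    ae_eventually_norm_block_lt b hα hg_law hg_indep] with ω hω hev
  set φ := randomData α b (fun n k => g n k ω) with hφ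
  have hsum : HasSum (fun n => (randomHarmonic α b (fun n k => g n k ω) n : L2S2)) φ := by
    simp only [coe_randomHarmonic]
    exact hω.hasSum
  have hcomp : ∀ n, component n φ = randomHarmonic α b (fun n k => g n k ω) n :=
    component_eq_of_hasSum hsum
  constructor
  · set p : ℝ := (2 : ℝ) ^ ((1 - α) / 2) with hp
    have hp0 : 0 < p := by positivity
    have hp1 : p < 1 := Real.rpow_lt_one_of_one_lt_of_neg (by norm_num) (by linarith)
    have hle : ∀ᶠ j in atTop, blockSup φ j ≤
        ENNReal.ofReal (2 * p ^ j + 24 * ‖φ‖ * (1 / 2) ^ j) := by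
      filter_upwards [hev] with j hj
      refine blockSup_le_of_grid hn φ j fun k hk l hl m hm => ?_
      simp only [blockFlow, hcomp]
      exact (hj k hk l hl m hm).le
    have hs : Summable fun j : ℕ => 2 * p ^ j + 24 * ‖φ‖ * (1 / 2) ^ j :=
      ((summable_geometric_of_lt_one hp0.le hp1).mul_left _).add
        ((summable_geometric_of_lt_one (by norm_num) (by norm_num)).mul_left _)
    have hs' : Summable fun j => (blockSup φ j).toReal := by
      refine Summable.of_norm_bounded_eventually_nat hs ?_
      filter_upwards [hle] with j hj
      rw [Real.norm_of_nonneg ENNReal.toReal_nonneg]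
      exact ENNReal.toReal_le_of_le_ofReal (by positivity) hj
    have h := hs'.tsum_ofReal_ne_top
    rwa [tsum_congr fun j => ENNReal.ofReal_toReal (blockSup_ne_top hn φ j)] at h
  · have h := hasSum_schrodingerFlow 0 φ
    simp only [phase_zero, one_smul, hcomp] at h
    exact sub_eq_zero.2 (h.unique hsum)

end RandomData

end

end SphereSchrodinger

open SphereSchrodinger in
theorem theorem1p2 {Ω : Type*} [MeasurableSpace Ω] (P : Measure Ω) [IsProbabilityMeasure P]
    (α : ℝ) (hα : 1 < α)
    (b : ∀ n : ℕ, OrthonormalBasis (Order n) ℂ (harmonicSpace n))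
    (g : ∀ n : ℕ, Order n → Ω → ℂ)
    (hg_law : ∀ (n : ℕ) (k : Order n), HasLaw (g n k) stdComplexGaussian P)
    (hg_indep : iIndepFun (fun p : (Σ n : ℕ, Order n) => g p.1 p.2) P) :
    (∀ᵐ ω ∂P, Summable (randomPart α b (fun n k => g n k ω))) ∧
    AEMeasurable (fun ω => randomData α b (fun n k => g n k ω)) P ∧
    ∀ᵐ φ ∂(dataLaw P α b g), ∃ u : ℝ → S2 → ℂ, IsContinuousVersion φ u ∧
      (∀ᵐ x ∂sphereMeasure, Tendsto (fun t : ℝ => u t x) (𝓝 0) (𝓝 (φ x))) ∧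
      TendstoUniformly u (u 0) (𝓝 0) ∧
      Tendsto (fun t : ℝ => eLpNorm (fun x => schrodingerFlow t φ x - φ x) ∞ sphereMeasure)
        (𝓝 0) (𝓝 0) := by
  have : ∀ n, FiniteDimensional ℂ (harmonicSpace n) := fun n =>
    Module.Finite.of_basis (b n).toBasis
  have hm := aemeasurable_randomData b hα hg_law
  refine ⟨ae_summable_randomPart b hα hg_law, hm, ?_⟩
  have hgood : ∀ᵐ φ ∂(dataLaw P α b g), φ ∈ goodSet :=
    (ae_map_iff hm measurableSet_goodSet).2 (ae_randomData_mem_goodSet b hα hg_law hg_indep)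
  filter_upwards [hgood] with φ hφ
  have hu := isContinuousVersion_tsum_blockFlow hφ.1
  have h0 : schrodingerFlow 0 φ = φ := sub_eq_zero.1 hφ.2
  exact ⟨_, hu, hu.tendsto_ae h0, hu.tendstoUniformly, hu.tendsto_eLpNorm h0⟩
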